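/- **Setting.** Let $L,l:\mathbb{R}^n\to\mathbb{R}$ and $P_i:\mathbb{R}^n\to\mathbb{R}_+$ ($i=1,\dots,J$) be convex. For $r\in\mathbb{R}^J$ put $\mathcal F(r)=\{x: P_i(x)\le r_i,\ i=1,\dots,J\}$, $S_c(r)=\arg\min_{x\in\mathcal F(r)} l(x)$ and $v(r)=\inf_{x\in\mathcal F(r)} l(x)\in[-\infty,+\infty]$ (with $v(r)=+\infty$ if $\mathcal F(r)=\emptyset$). Assume that for every $r$ with all $r_i>0$ the set $\mathcal F(r)$ is nonempty and $l$ is bounded below on it. Let $\Sigma=\mathbb{R}^n\times\mathbb{R}_+^J$, $\mathcal N$ the normal cone of convex analysis, $v^*$ the Fenchel conjugate of $v$, $\delta_\Sigma$ the indicator function of $\Sigma$, and $$\mathcal M(x,r)=\Big\{\gamma\in\mathbb{R}^J_+:\ 0\in\partial l(x)+\sum_{i}\gamma_i\partial P_i(x),\ \gamma_i(P_i(x)-r_i)=0\ \forall i\Big\}.$$ Subdifferentials of the convex functions $L,l,P_i,v,\phi_k$ are those of convex analysis. The DC reformulation is $$\min_{x,\ r\in\mathbb{R}^J_+} L(x)\quad\text{s.t.}\quad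 l(x)-v(r)\le 0,\quad P_i(x)\le r_i,\ i=1,\dots,J. \tag{5}$$ A feasible point $(\bar x,\bar r)$ of (5) is a KKT stationary solution if there are $\eta\ge0$ and $\lambda\in\mathbb{R}^J_+$ with $0\in\partial L(\bar x)+\eta\,\partial l(\bar x)+\sum_i\lambda_i\partial P_i(\bar x)$, $\lambda\in-\eta\,\partial v(\bar r)+\mathcal N_{\mathbb{R}^J_+}(\bar r)$ and $\lambda_i(P_i(\bar x)-\bar r_i)=0$ for all $i$. **Algorithm (VF-iDCA).** Let $\rho,c_\alpha,\delta_\alpha,\alpha_0>0$. A run consists of infinite sequences $z^k=(x^k,r^k)\in\Sigma$, $\tilde x^k\in S_c(r^k)$, $\gamma^k\in\mathcal M(\tilde x^k,r^k)$ and $\alpha_k$ ($k\ge0$; no stopping test) such that, with $$g_k(x,r)=\max_{i=1,\dots,J}\{0,\ l(x)-l(\tilde x^k)+\langle\gamma^k,r-r^k\rangle,\ P_i(x)-r_i\},\qquad \phi_k(z)=L(x)+\tfrac{\rho}{2}\|z-z^k\|^2+\alpha_k g_k(z),$$ one has $$\mathrm{dist}\big(0,\partial\phi_k(z^{k+1})+\mathcal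 N_\Sigma(z^{k+1})\big)\le\tfrac{\sqrt2}{2}\rho\|z^k-z^{k-1}\|\quad(k\ge1),$$ and for all $k\ge0$, with $t^{k+1}=g_k(z^{k+1})$ and $\Delta^{k+1}=\|z^{k+1}-z^k\|$, $$\alpha_{k+1}=\alpha_k+\delta_\alpha\ \text{ if } \max\{\alpha_k,1/t^{k+1}\}<c_\alpha/\Delta^{k+1},\qquad \alpha_{k+1}=\alpha_k\ \text{ otherwise}$$ (division by $0$ gives $+\infty$). **Merit function.** For $z=(x,r)$, $z_0\in\mathbb{R}^n\times\mathbb{R}^J$ and $\gamma\in\mathbb{R}^J$, $$E_\alpha(z,z_0,\gamma)=L(x)+\tfrac{\rho}{4}\|z-z_0\|^2+\delta_\Sigma(z)+\alpha\max_{i=1,\dots,J}\{0,\ l(x)+\langle\gamma,r\rangle+v^*(-\gamma),\ P_i(x)-r_i\}.$$ **KL functions.** Let $\partial$ denote the limiting subdifferential. A proper lower semicontinuous $\sigma:\mathbb{R}^d\to(-\infty,+\infty]$ is a KL function if for every $\bar y$ with $\partial\sigma(\bar y)\ne\emptyset$ there are $\eta\in(0,+\infty]$, a neighbourhood $\mathcal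 Y$ of $\bar y$ and a concave continuous $\varphi:[0,\eta)\to[0,+\infty)$ with $\varphi(0)=0$, $\varphi\in C^1(0,\eta)$ and $\varphi'>0$ on $(0,\eta)$, such that $\varphi'(\sigma(y)-\sigma(\bar y))\,\mathrm{dist}(0,\partial\sigma(y))\ge1$ for all $y\in\mathcal Y$ with $\sigma(\bar y)<\sigma(y)<\sigma(\bar y)+\eta$ (where $\mathrm{dist}(0,\emptyset)=+\infty$). **Theorem.** Suppose that $L$ is bounded below, that the sequences $\{z^k\}$ and $\{\alpha_k\}$ of a run of VF-iDCA are bounded, that the merit function $E_{\bar\alpha}$ is a KL function for the value $\bar\alpha$ with $\alpha_k=\bar\alpha$ for all large $k$ (such a value exists since $\{\alpha_k\}$ is bounded), and that there is $\delta>0$ with $r^k_i\ge\delta$ for all $k$ and all $i=1,\dots,J$. Then the whole sequence $\{z^k\}$ converges to a KKT stationary solution of (5). -/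

import Mathlib

open Set Filter Topology
open scoped Pointwise ENNReal

namespace ValueFunctionDCA

noncomputable section

/-! ### Variational analysis: subdifferentials, normal cones, the KL property -/

section Variational

variable {H : Type*} [NormedAddCommGroup H] [InnerProductSpace ℝ H]

/-- The subdifferential of convex analysis of an extended-valued function. -/
def convexSubdiff (f : H → EReal) (x : H) : Set H :=
  {ξ | f x ≠ ⊤ ∧ f x ≠ ⊥ ∧ ∀ y, f x + ((inner ℝ ξ (y - x) : ℝ) : EReal) ≤ f y}

/-- The subdifferential of convex analysis of a real-valued function. -/
def realSubdiff (f : H → ℝ) (x : H) : Set H := convexSubdiff (fun y => (f y : EReal)) x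

/-- The normal cone of convex analysis (empty at points outside of the set). -/
def normalCone (C : Set H) (x : H) : Set H :=
  {ξ | x ∈ C ∧ ∀ y ∈ C, inner ℝ ξ (y - x) ≤ (0 : ℝ)}

/-- The Fréchet (regular) subdifferential. -/
def frechetSubdiff (f : H → EReal) (x : H) : Set H :=
  {ξ | f x ≠ ⊤ ∧ f x ≠ ⊥ ∧ ∀ ε : ℝ, 0 < ε →
    ∀ᶠ y in 𝓝 x, f x + ((inner ℝ ξ (y - x) - ε * ‖y - x‖ : ℝ) : EReal) ≤ f y}

/-- The limiting (Mordukhovich) subdifferential. -/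
def limitingSubdiff (f : H → EReal) (x : H) : Set H :=
  {ξ | f x ≠ ⊤ ∧ f x ≠ ⊥ ∧ ∃ (u : ℕ → H) (ζ : ℕ → H),
    (∀ m, ζ m ∈ frechetSubdiff f (u m)) ∧ Tendsto u atTop (𝓝 x) ∧
      Tendsto (fun m => f (u m)) atTop (𝓝 (f x)) ∧ Tendsto ζ atTop (𝓝 ξ)}

/-- The class `Φ_η` of desingularizing functions on `[0, η)`, where `η ∈ (0, +∞]`. -/
structure IsDesingularizing (η : EReal) (φ : ℝ → ℝ) : Prop where
  concave : ConcaveOn ℝ {s : ℝ | 0 ≤ s ∧ (s : EReal) < η} φ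
  continuous : ContinuousOn φ {s : ℝ | 0 ≤ s ∧ (s : EReal) < η}
  nonneg : ∀ s : ℝ, 0 ≤ s → (s : EReal) < η → 0 ≤ φ s
  map_zero : φ 0 = 0
  contDiff : ContDiffOn ℝ 1 φ {s : ℝ | 0 < s ∧ (s : EReal) < η}
  deriv_pos : ∀ s : ℝ, 0 < s → (s : EReal) < η → 0 < deriv φ s

/-- The Kurdyka–Łojasiewicz property at a point.  The distance to the empty set is `+∞`. -/
def HasKLAt (σ : H → EReal) (ybar : H) : Prop :=
  ∃ η : EReal, 0 < η ∧ ∃ Y ∈ 𝓝 ybar, ∃ φ : ℝ → ℝ, IsDesingularizing η φ ∧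
    ∀ y ∈ Y, σ ybar < σ y → σ y < σ ybar + η →
      1 ≤ ENNReal.ofReal (deriv φ (σ y - σ ybar).toReal) *
        Metric.infEDist 0 (limitingSubdiff σ y)

/-- A KL function: proper, lower semicontinuous, with the KL property on `dom ∂σ`. -/
structure IsKLFunction (σ : H → EReal) : Prop where
  ne_bot : ∀ y, σ y ≠ ⊥
  exists_ne_top : ∃ y, σ y ≠ ⊤
  lsc : LowerSemicontinuous σ
  kl : ∀ y, (limitingSubdiff σ y).Nonempty → HasKLAt σ y

/-- The indicator function of convex analysis: `0` on `C`, `+∞` outside. -/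
def indicatorFn (C : Set H) (x : H) : EReal :=
  ⨅ _ : x ∈ C, (0 : EReal)

/-- The Fenchel conjugate `f*(ξ) = sup_r {⟨ξ, r⟩ - f(r)}`. -/
def conjugate (f : H → EReal) (ξ : H) : EReal :=
  ⨆ r, (((inner ℝ ξ r : ℝ) : EReal) - f r)

end Variational

/-! ### The bilevel problem -/

/-- `ℝᵈ` with its Euclidean norm. -/
abbrev Vec (d : ℕ) := EuclideanSpace ℝ (Fin d)

/-- Pairs `z = (x, r) ∈ ℝⁿ × ℝᴶ`, with the Euclidean norm; `x = z.fst`, `r = z.snd`. -/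
abbrev Pt (n J : ℕ) := WithLp 2 (Vec n × Vec J)

/-- Triples `(z, z₀, γ)`, with the Euclidean norm. -/
abbrev Triple (n J : ℕ) := WithLp 2 (Pt n J × WithLp 2 (Pt n J × Vec J))

/-- The nonnegative orthant `ℝ₊ᴶ`. -/
def orthant (J : ℕ) : Set (Vec J) := {r | ∀ i, 0 ≤ r i}

/-- `Σ = ℝⁿ × ℝ₊ᴶ`. -/
def sigmaSet (n J : ℕ) : Set (Pt n J) := {z | z.snd ∈ orthant J}

section Problem

variable {n J : ℕ}

/-- The lower-level feasible set `F(r) = {x | P_i(x) ≤ r_i for all i}`. -/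
def feasible (P : Fin J → Vec n → ℝ) (r : Vec J) : Set (Vec n) :=
  {x | ∀ i, P i x ≤ r i}

/-- The solution set `S_c(r)` of the constrained lower-level problem. -/
def solutionSet (l : Vec n → ℝ) (P : Fin J → Vec n → ℝ) (r : Vec J) : Set (Vec n) :=
  {x | x ∈ feasible P r ∧ ∀ y ∈ feasible P r, l x ≤ l y}

/-- The lower-level value function `v(r)`, equal to `+∞` where `F(r)` is empty. -/
def valueFn (l : Vec n → ℝ) (P : Fin J → Vec n → ℝ) (r : Vec J) : EReal :=
  ⨅ x ∈ feasible P r, (l x : EReal)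

/-- The set `M(x, r)` of KKT multipliers of the lower-level problem. -/
def multipliers (l : Vec n → ℝ) (P : Fin J → Vec n → ℝ) (x : Vec n) (r : Vec J) :
    Set (Vec J) :=
  {γ | γ ∈ orthant J ∧ (0 : Vec n) ∈ realSubdiff l x + ∑ i, γ i • realSubdiff (P i) x ∧
    ∀ i, γ i * (P i x - r i) = 0}

/-- KKT stationary solutions of `min L(x)` over `x`, `r ≥ 0` subject to `l(x) - v(r) ≤ 0` and
`P_i(x) ≤ r_i`. -/
def IsKKTStationary (L l : Vec n → ℝ) (P : Fin J → Vec n → ℝ) (z : Pt n J) : Prop :=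
  z ∈ sigmaSet n J ∧ (l z.fst : EReal) ≤ valueFn l P z.snd ∧ (∀ i, P i z.fst ≤ z.snd i) ∧
    ∃ (η : ℝ) (lam : Vec J), 0 ≤ η ∧ lam ∈ orthant J ∧
      (0 : Vec n) ∈ realSubdiff L z.fst + η • realSubdiff l z.fst
        + ∑ i, lam i • realSubdiff (P i) z.fst ∧
      lam ∈ (-η) • convexSubdiff (valueFn l P) z.snd + normalCone (orthant J) z.snd ∧
      ∀ i, lam i * (P i z.fst - z.snd i) = 0

/-! ### The algorithm and the merit function -/

/-- `max_i {0, V(x, r), P_i(x) - r_i}` with `V(x, r) = l(x) - l(xt) + ⟨γ, r - rk⟩`, where `rk` is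
the current `r`-iterate, `xt` a lower-level solution at `rk` and `γ` a multiplier.
(For `J = 0` the last supremum is `0`, which does not change the maximum.) -/
def linGap (l : Vec n → ℝ) (P : Fin J → Vec n → ℝ) (rk : Vec J) (xt : Vec n) (γ : Vec J)
    (z : Pt n J) : ℝ :=
  max (max 0 (l z.fst - l xt + inner ℝ γ (z.snd - rk))) (⨆ i, (P i z.fst - z.snd i))

/-- The objective `φ_k` of the subproblem at `zk`, with proximal parameter `ρ` and penalty `a`. -/
def subObjective (L l : Vec n → ℝ) (P : Fin J → Vec n → ℝ) (ρ a : ℝ) (zk : Pt n J)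
    (xt : Vec n) (γ : Vec J) (z : Pt n J) : ℝ :=
  L z.fst + ρ / 2 * ‖z - zk‖ ^ 2 + a * linGap l P zk.snd xt γ z

/-- `(z, xt, γ, α)` is an (infinite) run of VF-iDCA with parameters `ρ, c, d`: iterates `z k`,
lower-level solutions `xt k`, multipliers `γ k` and penalties `α k`.
The inexactness criterion refers to two earlier iterates, so it is imposed for `k ≥ 1` (it is
written with `k + 1` for `k`); the first step only has to stay in `Σ`.
In the penalty update, quotients are taken in `[0, +∞]`, where `1 / 0 = c / 0 = +∞`. -/
structure IsVFiDCARun (L l : Vec n → ℝ) (P : Fin J → Vec n → ℝ) (ρ c d : ℝ)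
    (z : ℕ → Pt n J) (xt : ℕ → Vec n) (γ : ℕ → Vec J) (α : ℕ → ℝ) : Prop where
  mem_sigma : ∀ k, z k ∈ sigmaSet n J
  penalty_pos : 0 < α 0
  lower_solution : ∀ k, xt k ∈ solutionSet l P (z k).snd
  multiplier : ∀ k, γ k ∈ multipliers l P (xt k) (z k).snd
  inexact : ∀ k,
    Metric.infEDist 0
      (realSubdiff (subObjective L l P ρ (α (k + 1)) (z (k + 1)) (xt (k + 1)) (γ (k + 1)))
          (z (k + 2))
        + normalCone (sigmaSet n J) (z (k + 2)))
      ≤ ENNReal.ofReal (√2 / 2 * ρ * ‖z (k + 1) - z k‖)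
  penalty_update : ∀ k, α (k + 1) =
    if max (ENNReal.ofReal (α k))
        (1 / ENNReal.ofReal (linGap l P (z k).snd (xt k) (γ k) (z (k + 1))))
        < ENNReal.ofReal c / ENNReal.ofReal ‖z (k + 1) - z k‖
    then α k + d else α k

/-- The merit function
`E_a(z, z₀, γ) = L(x) + (ρ/4) ‖z - z₀‖² + δ_Σ(z)
  + a max_i {0, l(x) + ⟨γ, r⟩ + v*(-γ), P_i(x) - r_i}`. -/
def merit (L l : Vec n → ℝ) (P : Fin J → Vec n → ℝ) (ρ a : ℝ) (w : Triple n J) : EReal :=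
  let z := w.fst
  let z₀ := w.snd.fst
  let γ := w.snd.snd
  ((L z.fst + ρ / 4 * ‖z - z₀‖ ^ 2 : ℝ) : EReal) + indicatorFn (sigmaSet n J) z
    + (a : EReal) *
      max (max 0 (((l z.fst + inner ℝ γ z.snd : ℝ) : EReal) + conjugate (valueFn l P) (-γ)))
        (⨆ i, ((P i z.fst - z.snd i : ℝ) : EReal))

end Problem

end

end ValueFunctionDCA

open ValueFunctionDCA

/-!
Eventually the penalty has a constant value `a`.  Since `γᵏ ∈ 𝓜(x̃ᵏ, rᵏ)` means
`-γᵏ ∈ ∂v(rᵏ)`, Fenchel's equality `l(x̃ᵏ) - ⟨γᵏ, rᵏ⟩ = -v*(-γᵏ)` identifies the linearised gap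
`g_k` with the one inside the merit function, so that `E_a(zᵏ⁺¹, zᵏ, γᵏ)` is the subproblem's
objective with `ρ/4` in place of `ρ/2`.  Strong convexity of the subproblem and the inexactness
criterion make this value decrease by at least `(ρ/4)‖zᵏ⁺¹ - zᵏ‖²`, and an approximate solution of
the subproblem yields a Fréchet subgradient of `E_a` of norm `O(‖zᵏ⁺¹ - zᵏ‖ + ‖zᵏ - zᵏ⁻¹‖)`.  The
Kurdyka–Łojasiewicz inequality then makes the path finite, provided that the `γᵏ` are bounded; this
follows from a point strictly feasible for all `rᵏ` at once.

At the limit the gap vanishes, because `a` is no longer updated.  Writing subgradients of a maximum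
as convex combinations, the optimality conditions of the subproblems hold with multipliers in a
compact set, and a limit of them gives the KKT system.
-/

namespace ValueFunctionDCA

/-! ### Subgradients of convex functions -/

section ConvexExtension

variable {E K : Type*} [NormedAddCommGroup E] [NormedSpace ℝ E] [NormedAddCommGroup K]
  [NormedSpace ℝ K]

theorem convex_strict_epigraph_partial_iInf {F : E × K → ℝ} (hF : ConvexOn ℝ univ F) :
    Convex ℝ {p : K × ℝ | ∃ y, F (y, p.1) < p.2} := by
  rintro ⟨v, s⟩ ⟨y, hy⟩ ⟨w, t⟩ ⟨y', hy'⟩ a b ha hb hab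
  exact ⟨a • y + b • y', (hF.convex_strict_epigraph (x := ((y, v), s)) ⟨mem_univ _, hy⟩
    (y := ((y', w), t)) ⟨mem_univ _, hy'⟩ ha hb hab).2⟩

theorem exists_subgradient_extension {F : E × K → ℝ} (hF : ConvexOn ℝ univ F)
    (hcont : Continuous F) {x : E} {u : K} {ξ : E →L[ℝ] ℝ}
    (hξ : ∀ y, F (x, u) + ξ (y - x) ≤ F (y, u)) :
    ∃ η : K →L[ℝ] ℝ, ∀ y v, F (x, u) + ξ (y - x) + η (v - u) ≤ F (y, v) := by
  set A : Set (K × ℝ) := {p | ∃ y, F (y, p.1) - ξ y < p.2}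
  have hopen : IsOpen A := by
    simp only [A, ofPred_exists]
    exact isOpen_iUnion fun y => isOpen_lt (by fun_prop) continuous_snd
  have hconv : Convex ℝ A := convex_strict_epigraph_partial_iInf <| hF.sub <|
    (ξ.comp (ContinuousLinearMap.fst ℝ E K)).toLinearMap.concaveOn convex_univ
  have hbase : (u, F (x, u) - ξ x) ∉ A := by
    rintro ⟨y, hy⟩
    have := hξ y
    rw [map_sub] at this
    linarith
  obtain ⟨G, hG⟩ := geometric_hahn_banach_open_point hconv hopen hbase
  have hsplit (v : K) (t : ℝ) : G (v, t) = G (v, 0) + t * G (0, 1) := by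
    rw [← smul_eq_mul, ← map_smul, ← map_add]
    simp
  have hvert : G (0, 1) < 0 := by
    have := hG (u, F (x, u) - ξ x + 1) ⟨x, by simp⟩
    rw [hsplit, hsplit u (F (x, u) - ξ x)] at this
    linarith
  refine ⟨(-(G (0, 1))⁻¹) • G.comp (ContinuousLinearMap.inl ℝ K ℝ), fun y v => ?_⟩
  refine le_of_forall_pos_lt_add fun ε hε => ?_
  have hlt := hG (v, F (y, v) - ξ y + ε) ⟨y, by simpa using hε⟩
  rw [hsplit, hsplit u, ← sub_neg] at hlt
  have hdiv := mul_pos_of_neg_of_neg hlt (inv_lt_zero.2 hvert)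
  have hcancel : G (0, 1) * (G (0, 1))⁻¹ = 1 := mul_inv_cancel₀ hvert.ne
  have hη : ((-(G (0, 1))⁻¹) • G.comp (ContinuousLinearMap.inl ℝ K ℝ)) (v - u)
      = (G (u, 0) - G (v, 0)) * (G (0, 1))⁻¹ := by
    rw [map_sub]
    simp
    ring
  rw [hη, map_sub]
  linear_combination hdiv + (F (y, v) - ξ y + ε - F (x, u) + ξ x) * hcancel

end ConvexExtension

section Subdifferential

variable {H : Type*} [NormedAddCommGroup H] [InnerProductSpace ℝ H]

theorem mem_realSubdiff {f : H → ℝ} {x ξ : H} :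
    ξ ∈ realSubdiff f x ↔ ∀ y, f x + inner ℝ ξ (y - x) ≤ f y := by
  simp only [realSubdiff, convexSubdiff, mem_ofPred_eq, ne_eq, EReal.coe_ne_top, not_false_eq_true,
    EReal.coe_ne_bot, true_and, ← EReal.coe_add, EReal.coe_le_coe_iff]

theorem realSubdiff_const (c : ℝ) (x : H) : realSubdiff (fun _ => c) x = {0} := by
  refine Subset.antisymm (fun ξ hξ => ?_) (singleton_subset_iff.2 (mem_realSubdiff.2 (by simp)))
  have h := mem_realSubdiff.1 hξ (x + ξ)
  rw [add_sub_cancel_left, real_inner_self_eq_norm_sq] at h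
  simpa using le_antisymm (by linarith : ‖ξ‖ ^ 2 ≤ 0) (sq_nonneg _)

theorem isClosed_realSubdiff (f : H → ℝ) (x : H) : IsClosed (realSubdiff f x) := by
  have h : realSubdiff f x = ⋂ y, {ξ | f x + inner ℝ ξ (y - x) ≤ f y} := by
    ext ξ
    simp [mem_realSubdiff]
  rw [h]
  exact isClosed_iInter fun y => isClosed_le (by fun_prop) continuous_const

theorem isClosed_normalCone (C : Set H) (x : H) : IsClosed (normalCone C x) := by
  have h : normalCone C x = {_ξ | x ∈ C} ∩ ⋂ y ∈ C, {ξ | inner ℝ ξ (y - x) ≤ (0 : ℝ)} := by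
    ext ξ
    simp [normalCone]
  rw [h]
  exact isClosed_const.inter
    (isClosed_biInter fun y _ => isClosed_le (by fun_prop) continuous_const)

theorem continuous_of_convexOn_univ {E : Type*} [NormedAddCommGroup E] [NormedSpace ℝ E]
    [FiniteDimensional ℝ E] {f : E → ℝ} (hf : ConvexOn ℝ univ f) : Continuous f :=
  continuousOn_univ.1 (hf.continuousOn isOpen_univ)

theorem convexOn_sum {E ι : Type*} [AddCommGroup E] [Module ℝ E] (s : Finset ι)
    {f : ι → E → ℝ} (hf : ∀ i ∈ s, ConvexOn ℝ univ (f i)) :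
    ConvexOn ℝ univ (∑ i ∈ s, f i) :=
  Finset.sum_induction f (ConvexOn ℝ univ) (fun _ _ => ConvexOn.add)
    (convexOn_const 0 convex_univ) hf

theorem subgradient_of_sub_sq_le {E : Type*} [NormedAddCommGroup E] [NormedSpace ℝ E]
    {f : E → ℝ} {C : Set E} (hf : ConvexOn ℝ C f) {x : E} (hx : x ∈ C) {F : E →ₗ[ℝ] ℝ} {K : ℝ}
    (h : ∀ y ∈ C, f x + F (y - x) - K * ‖y - x‖ ^ 2 ≤ f y) {y : E} (hy : y ∈ C) :
    f x + F (y - x) ≤ f y := by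
  have hsegment : ∀ t ∈ Ioc (0 : ℝ) 1, f x + F (y - x) - t * (K * ‖y - x‖ ^ 2) ≤ f y := by
    rintro t ⟨ht0, ht1⟩
    have hlower := h _ (hf.1 hx hy (sub_nonneg.2 ht1) ht0.le (sub_add_cancel 1 t))
    have hupper := hf.2 hx hy (sub_nonneg.2 ht1) ht0.le (sub_add_cancel 1 t)
    have hsub : (1 - t) • x + t • y - x = t • (y - x) := by module
    rw [hsub, map_smul, norm_smul, mul_pow, Real.norm_eq_abs, sq_abs] at hlower
    simp only [smul_eq_mul] at hlower hupper
    refine le_of_mul_le_mul_left ?_ ht0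
    linarith
  have hlim : Tendsto (fun t : ℝ => f x + F (y - x) - t * (K * ‖y - x‖ ^ 2)) (𝓝[>] 0)
      (𝓝 (f x + F (y - x))) :=
    ((Continuous.tendsto' (by fun_prop) 0 _ (by simp)).mono_left nhdsWithin_le_nhds)
  refine le_of_tendsto hlim ?_
  filter_upwards [Ioc_mem_nhdsGT (zero_lt_one' ℝ)] with t ht using hsegment t ht

theorem sub_smul_mem_realSubdiff {f : H → ℝ} (hf : ConvexOn ℝ univ f) {ρ : ℝ} {x x₀ ξ : H}
    (hξ : ξ ∈ realSubdiff (fun y => f y + ρ / 2 * ‖y - x₀‖ ^ 2) x) :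
    ξ - ρ • (x - x₀) ∈ realSubdiff f x := by
  refine mem_realSubdiff.2 fun y => ?_
  refine subgradient_of_sub_sq_le (F := innerₛₗ ℝ (ξ - ρ • (x - x₀))) (K := ρ / 2) hf (mem_univ x)
    (fun w _ => ?_) (mem_univ y)
  have hsq : ‖w - x₀‖ ^ 2 = ‖x - x₀‖ ^ 2 + 2 * inner ℝ (x - x₀) (w - x) + ‖w - x‖ ^ 2 := by
    rw [← norm_add_sq_real, add_comm (x - x₀), sub_add_sub_cancel]
  have hw := mem_realSubdiff.1 hξ w
  rw [hsq] at hw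
  rw [innerₛₗ_apply_apply, inner_sub_left, real_inner_smul_left]
  linarith

section FiniteDimensional

variable [FiniteDimensional ℝ H] {f g : H → ℝ}

theorem realSubdiff_nonempty (hf : ConvexOn ℝ univ f) (x : H) : (realSubdiff f x).Nonempty := by
  obtain ⟨η, hη⟩ := exists_subgradient_extension (E := H) (x := x) (u := x) (ξ := 0)
    (hf.comp_linearMap (LinearMap.snd ℝ H H))
    ((continuous_of_convexOn_univ hf).comp continuous_snd) (by simp)
  refine ⟨(InnerProductSpace.toDual ℝ H).symm η, mem_realSubdiff.2 fun y => ?_⟩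
  simpa using hη x y

theorem isCompact_realSubdiff (hf : ConvexOn ℝ univ f) (x : H) : IsCompact (realSubdiff f x) := by
  refine Metric.isCompact_of_isClosed_isBounded (isClosed_realSubdiff f x) ?_
  obtain ⟨M, hM⟩ := (isCompact_closedBall x 1).bddAbove_image
    (continuous_of_convexOn_univ hf).continuousOn
  refine isBounded_iff_forall_norm_le.2 ⟨M - f x, fun ξ hξ => ?_⟩
  have hball : x + ‖ξ‖⁻¹ • ξ ∈ Metric.closedBall x 1 := by
    rw [mem_closedBall_iff_norm, add_sub_cancel_left, norm_smul, norm_inv, norm_norm]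
    exact inv_mul_le_one
  have hle := (mem_realSubdiff.1 hξ _).trans (hM (mem_image_of_mem f hball))
  have hinner : inner ℝ ξ (‖ξ‖⁻¹ • ξ) = ‖ξ‖ := by
    rw [real_inner_smul_right, real_inner_self_eq_norm_mul_norm, ← mul_assoc,
      inv_mul_mul_self]
  rw [add_sub_cancel_left, hinner] at hle
  linarith

-- A subgradient at `0` of `v ↦ inf_y (f y + g (y + v) - ⟨ξ, y⟩)` is the part of `ξ` due to `g`.
theorem realSubdiff_add (hf : ConvexOn ℝ univ f) (hg : ConvexOn ℝ univ g) (x : H) :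
    realSubdiff (f + g) x = realSubdiff f x + realSubdiff g x := by
  refine Subset.antisymm (fun ξ hξ => ?_) ?_
  · obtain ⟨η, hη⟩ := exists_subgradient_extension (F := fun p : H × H => f p.1 + g (p.1 + p.2))
      (x := x) (u := 0) (ξ := innerSL ℝ ξ)
      ((hf.comp_linearMap (LinearMap.fst ℝ H H)).add
        (hg.comp_linearMap (LinearMap.fst ℝ H H + LinearMap.snd ℝ H H)))
      (by
        have := continuous_of_convexOn_univ hf
        have := continuous_of_convexOn_univ hg
        fun_prop)
      (by simpa using mem_realSubdiff.1 hξ)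
    set ζ := (InnerProductSpace.toDual ℝ H).symm η
    have hζ (v : H) : η v = inner ℝ ζ v := InnerProductSpace.toDual_symm_apply.symm
    simp only [hζ, innerSL_apply_apply, add_zero, sub_zero] at hη
    refine ⟨ξ - ζ, mem_realSubdiff.2 fun y => ?_, ζ, mem_realSubdiff.2 fun y => ?_,
      sub_add_cancel ξ ζ⟩
    · have := hη y (x - y)
      rw [add_sub_cancel, ← neg_sub y x, inner_neg_right] at this
      rw [inner_sub_left]
      linarith
    · have := hη x (y - x)
      rw [add_sub_cancel, sub_self, inner_zero_right] at this
      linarith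
  · rintro _ ⟨ξ, hξ, ζ, hζ, rfl⟩
    refine mem_realSubdiff.2 fun y => ?_
    simp only [Pi.add_apply, inner_add_left]
    linarith [mem_realSubdiff.1 hξ y, mem_realSubdiff.1 hζ y]

theorem realSubdiff_const_smul (hf : ConvexOn ℝ univ f) {c : ℝ} (hc : 0 ≤ c) (x : H) :
    realSubdiff (c • f) x = c • realSubdiff f x := by
  rcases hc.eq_or_lt with rfl | hc
  · rw [zero_smul, zero_smul_set (realSubdiff_nonempty hf x)]
    exact realSubdiff_const 0 x
  · ext ξ
    rw [mem_smul_set_iff_inv_smul_mem₀ hc.ne', mem_realSubdiff, mem_realSubdiff]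
    refine forall_congr' fun y => ?_
    rw [← mul_le_mul_iff_right₀ hc (b := f x + _), mul_add, real_inner_smul_left,
      mul_inv_cancel_left₀ hc.ne']
    rfl

theorem realSubdiff_sum {ι : Type*} (s : Finset ι) {f : ι → H → ℝ}
    (hf : ∀ i ∈ s, ConvexOn ℝ univ (f i)) (x : H) :
    realSubdiff (∑ i ∈ s, f i) x = ∑ i ∈ s, realSubdiff (f i) x := by
  classical
  induction s using Finset.induction_on with
  | empty => exact realSubdiff_const 0 x
  | insert i s hi ih =>
    have hs : ∀ j ∈ s, ConvexOn ℝ univ (f j) := fun j hj => hf j (Finset.mem_insert_of_mem hj)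
    rw [Finset.sum_insert hi, Finset.sum_insert hi,
      realSubdiff_add (hf i (Finset.mem_insert_self i s)) (convexOn_sum s hs), ih hs]

theorem exists_mem_norm_le_of_infEDist_le (hf : ConvexOn ℝ univ f) {C : Set H} {x : H} {t : ℝ}
    (ht : 0 ≤ t)
    (h : Metric.infEDist 0 (realSubdiff f x + normalCone C x) ≤ ENNReal.ofReal t) :
    ∃ ξ ∈ realSubdiff f x, ∃ ζ ∈ normalCone C x, ‖ξ + ζ‖ ≤ t := by
  have hne : (realSubdiff f x + normalCone C x).Nonempty := by
    by_contra hempty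
    rw [not_nonempty_iff_eq_empty.1 hempty, Metric.infEDist_empty] at h
    exact ENNReal.ofReal_ne_top (top_le_iff.1 h)
  have hclosed : IsClosed (realSubdiff f x + normalCone C x) :=
    (isClosed_normalCone C x).add_left_of_isCompact (isCompact_realSubdiff hf x)
  obtain ⟨_, ⟨ξ, hξ, ζ, hζ, rfl⟩, hdist⟩ := hclosed.exists_infDist_eq_dist hne 0
  refine ⟨ξ, hξ, ζ, hζ, ?_⟩
  rw [← dist_zero_left, ← hdist]
  exact ENNReal.toReal_le_of_le_ofReal ht h

end FiniteDimensional

end Subdifferential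

/-! ### Maxima of zero and finitely many convex functions -/

section PosMax

variable {ι : Type*}

/-- `max {0, u i}` over a finite index type `ι` (the supremum is `0` when `ι` is empty). -/
noncomputable def posMax (u : ι → ℝ) : ℝ := max 0 (⨆ i, u i)

theorem posMax_smul {c : ℝ} (hc : 0 ≤ c) (u : ι → ℝ) : posMax (c • u) = c * posMax u := by
  simp only [posMax, Pi.smul_apply, smul_eq_mul, mul_max_of_nonneg _ _ hc, mul_zero,
    Real.mul_iSup_of_nonneg hc]

section Finite

variable [Finite ι]

theorem posMax_le_iff {u : ι → ℝ} {t : ℝ} : posMax u ≤ t ↔ 0 ≤ t ∧ ∀ i, u i ≤ t := by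
  refine max_le_iff.trans <| and_congr_right fun ht => ⟨fun h i => ?_, fun h => Real.iSup_le h ht⟩
  exact (le_ciSup (finite_range u).bddAbove i).trans h

theorem posMax_nonneg (u : ι → ℝ) : 0 ≤ posMax u := (posMax_le_iff.1 le_rfl).1

theorem le_posMax (u : ι → ℝ) (i : ι) : u i ≤ posMax u := (posMax_le_iff.1 le_rfl).2 i

theorem convexOn_posMax {E : Type*} [AddCommGroup E] [Module ℝ E] {b : ι → E → ℝ}
    (hb : ∀ i, ConvexOn ℝ univ (b i)) : ConvexOn ℝ univ fun x => posMax fun i => b i x := by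
  refine ⟨convex_univ, fun x _ y _ s t hs ht hst => ?_⟩
  refine posMax_le_iff.2 ⟨add_nonneg (mul_nonneg hs (posMax_nonneg _))
    (mul_nonneg ht (posMax_nonneg _)), fun i => ?_⟩
  refine ((hb i).2 (mem_univ x) (mem_univ y) hs ht hst).trans (add_le_add ?_ ?_)
  · exact mul_le_mul_of_nonneg_left (le_posMax (fun i => b i x) i) hs
  · exact mul_le_mul_of_nonneg_left (le_posMax (fun i => b i y) i) ht

theorem coe_posMax (u : ι → ℝ) : (posMax u : EReal) = max 0 (⨆ i, (u i : EReal)) := by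
  refine le_antisymm ?_ (max_le (by exact_mod_cast posMax_nonneg u)
    (iSup_le fun i => by exact_mod_cast le_posMax u i))
  refine EReal.le_of_forall_lt_iff_le.1 fun t ht => ?_
  obtain ⟨h0, hu⟩ := max_lt_iff.1 ht
  exact EReal.coe_le_coe_iff.2 <| posMax_le_iff.2 ⟨by exact_mod_cast h0.le, fun i =>
    by exact_mod_cast (le_iSup (fun i => (u i : EReal)) i).trans hu.le⟩

end Finite

variable [Fintype ι] {c : ℝ} {u lam : ι → ℝ}

/-- The subdifferential of `c • posMax` at `u`, for `0 ≤ c`: the nonnegative weights of total mass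
at most `c` that attain the maximum. -/
def posMaxMultipliers (c : ℝ) (u : ι → ℝ) : Set (ι → ℝ) :=
  {lam | (∀ i, 0 ≤ lam i) ∧ ∑ i, lam i ≤ c ∧ ∑ i, lam i * u i = c * posMax u}

theorem le_of_mem_posMaxMultipliers (h : lam ∈ posMaxMultipliers c u) (i : ι) : lam i ≤ c :=
  (Finset.single_le_sum (fun j _ => h.1 j) (Finset.mem_univ i)).trans h.2.1

theorem sum_mul_le_of_mem_posMaxMultipliers (h : lam ∈ posMaxMultipliers c u) (w : ι → ℝ) :
    ∑ i, lam i * w i ≤ c * posMax w :=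
  calc ∑ i, lam i * w i ≤ ∑ i, lam i * posMax w :=
        Finset.sum_le_sum fun i _ => mul_le_mul_of_nonneg_left (le_posMax w i) (h.1 i)
    _ = (∑ i, lam i) * posMax w := (Finset.sum_mul ..).symm
    _ ≤ c * posMax w := mul_le_mul_of_nonneg_right h.2.1 (posMax_nonneg w)

theorem mul_posMax_sub_eq_zero_of_mem_posMaxMultipliers (h : lam ∈ posMaxMultipliers c u) (i : ι) :
    lam i * (posMax u - u i) = 0 := by
  have hnonneg : ∀ j ∈ Finset.univ, 0 ≤ lam j * (posMax u - u j) := fun j _ =>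
    mul_nonneg (h.1 j) (sub_nonneg.2 (le_posMax u j))
  refine (Finset.sum_eq_zero_iff_of_nonneg hnonneg).1 ?_ i (Finset.mem_univ i)
  refine le_antisymm ?_ (Finset.sum_nonneg hnonneg)
  simp only [mul_sub, Finset.sum_sub_distrib, h.2.2, ← Finset.sum_mul]
  exact sub_nonpos.2 (mul_le_mul_of_nonneg_right h.2.1 (posMax_nonneg u))

theorem mem_posMaxMultipliers_of_forall_le (hc : 0 ≤ c)
    (h : ∀ w, c * posMax u + ∑ i, lam i * (w i - u i) ≤ c * posMax w) :
    lam ∈ posMaxMultipliers c u := by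
  classical
  have hattained : ∑ i, lam i * u i = c * posMax u := by
    have h0 := h ((0 : ℝ) • u)
    have h2 := h ((2 : ℝ) • u)
    rw [posMax_smul le_rfl] at h0
    rw [posMax_smul zero_le_two] at h2
    simp only [Pi.smul_apply, smul_eq_mul, zero_mul, zero_sub, mul_neg, Finset.sum_neg_distrib,
      two_mul, add_sub_cancel_right] at h0 h2
    linarith
  have hle (w : ι → ℝ) : ∑ i, lam i * w i ≤ c * posMax w := by
    have := h w
    simp only [mul_sub, Finset.sum_sub_distrib, hattained] at this
    linarith
  refine ⟨fun i => ?_, ?_, hattained⟩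
  · have hneg : posMax (-Pi.single i (1 : ℝ)) ≤ 0 := by
      refine posMax_le_iff.2 ⟨le_rfl, fun j => ?_⟩
      exact neg_nonpos.2 ((Pi.single_nonneg.2 zero_le_one : (0 : ι → ℝ) ≤ Pi.single i 1) j)
    have hi := hle (-Pi.single i 1)
    simp only [Pi.neg_apply, Pi.single_apply, mul_neg, mul_ite, mul_one, mul_zero,
      Finset.sum_neg_distrib, Finset.sum_ite_eq', Finset.mem_univ, if_true] at hi
    linarith [mul_nonpos_of_nonneg_of_nonpos hc hneg]
  · have hone : posMax (fun _ : ι => (1 : ℝ)) ≤ 1 := posMax_le_iff.2 ⟨zero_le_one, fun _ => le_rfl⟩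
    have := hle fun _ => 1
    simp only [mul_one] at this
    exact this.trans (mul_le_of_le_one_right hc hone)

/-- The multipliers are a subgradient in the direction of the perturbations `w` of the entries of
the maximum `f y + c * posMax (b y + w)`. -/
theorem exists_mem_posMaxMultipliers {H : Type*} [NormedAddCommGroup H] [InnerProductSpace ℝ H]
    [FiniteDimensional ℝ H] {f : H → ℝ} {b : ι → H → ℝ} (hf : ConvexOn ℝ univ f)
    (hb : ∀ i, ConvexOn ℝ univ (b i)) (hc : 0 ≤ c) {x ξ : H}
    (hξ : ξ ∈ realSubdiff (fun y => f y + c * posMax fun i => b i y) x) :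
    ∃ lam ∈ posMaxMultipliers c (fun i => b i x), ξ ∈ realSubdiff (f + ∑ i, lam i • b i) x := by
  classical
  have hconv : ConvexOn ℝ univ fun p : H × (ι → ℝ) =>
      f p.1 + c * posMax fun i => b i p.1 + p.2 i :=
    (hf.comp_linearMap (LinearMap.fst ℝ H (ι → ℝ))).add <| ConvexOn.smul hc <|
      convexOn_posMax fun i => ((hb i).comp_linearMap (LinearMap.fst ℝ H (ι → ℝ))).add
        ((LinearMap.proj i ∘ₗ LinearMap.snd ℝ H (ι → ℝ)).convexOn convex_univ)
  obtain ⟨η, hη⟩ := exists_subgradient_extension (x := x) (u := 0) (ξ := innerSL ℝ ξ) hconv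
    (continuous_of_convexOn_univ hconv) (by simpa using mem_realSubdiff.1 hξ)
  set lam : ι → ℝ := fun i => η (Pi.single i 1)
  have hlam (w : ι → ℝ) : η w = ∑ i, lam i * w i := by
    conv_lhs => rw [pi_eq_sum_univ' w, map_sum]
    refine Finset.sum_congr rfl fun i _ => ?_
    rw [map_smul, smul_eq_mul, mul_comm]
  have hsub (y : H) (w : ι → ℝ) : f x + c * posMax (fun i => b i x) + inner ℝ ξ (y - x)
      + ∑ i, lam i * (w i - b i y) ≤ f y + c * posMax w := by
    have := hη y fun i => w i - b i y
    simpa [hlam] using this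
  have hmem : lam ∈ posMaxMultipliers c fun i => b i x :=
    mem_posMaxMultipliers_of_forall_le hc fun w => by simpa [add_assoc] using hsub x w
  refine ⟨lam, hmem, mem_realSubdiff.2 fun y => ?_⟩
  have := hsub y fun i => b i x
  simp only [mul_sub, Finset.sum_sub_distrib] at this
  simp only [Pi.add_apply, Finset.sum_apply, Pi.smul_apply, smul_eq_mul]
  linarith

end PosMax

/-! ### The value function and the linearised constraints -/

section Problem

variable {n J : ℕ} {l : Vec n → ℝ} {P : Fin J → Vec n → ℝ}

section ValueFunction

variable {r γ : Vec J} {x : Vec n}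

theorem valueFn_eq_of_mem_solutionSet (hx : x ∈ solutionSet l P r) : valueFn l P r = l x :=
  le_antisymm (iInf₂_le x hx.1) (le_iInf₂ fun y hy => EReal.coe_le_coe_iff.2 (hx.2 y hy))

theorem inner_eq_sum_mul (u v : Vec J) : inner ℝ u v = ∑ i, u i * v i := by
  simp only [PiLp.inner_apply, RCLike.inner_apply, conj_trivial, mul_comm]

theorem neg_mem_convexSubdiff_valueFn_iff (hx : valueFn l P r = l x) :
    -γ ∈ convexSubdiff (valueFn l P) r ↔
      ∀ r', ∀ y ∈ feasible P r', l x - inner ℝ γ (r' - r) ≤ l y := by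
  simp only [convexSubdiff, mem_ofPred_eq, hx, ne_eq, EReal.coe_ne_top, EReal.coe_ne_bot,
    not_false_eq_true, true_and, inner_neg_left, ← EReal.coe_add, ← sub_eq_add_neg]
  simp only [valueFn, le_iInf_iff, EReal.coe_le_coe_iff]

theorem neg_mem_convexSubdiff_valueFn (hx : x ∈ solutionSet l P r)
    (hγ : γ ∈ multipliers l P x r) : -γ ∈ convexSubdiff (valueFn l P) r := by
  refine (neg_mem_convexSubdiff_valueFn_iff (valueFn_eq_of_mem_solutionSet hx)).2 fun r' y hy => ?_
  obtain ⟨hnonneg, ⟨ξ, hξ, s, hs, hsum⟩, hcompl⟩ := hγ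
  obtain ⟨g, hg, rfl⟩ := (mem_finsetSum _ _ _).1 hs
  have hterm (i : Fin J) : inner ℝ (g i) (y - x) ≤ γ i * (r' - r) i := by
    obtain ⟨u, hu, hgu⟩ := hg (Finset.mem_univ i)
    have hle : γ i * (P i x + inner ℝ u (y - x)) ≤ γ i * r' i :=
      mul_le_mul_of_nonneg_left ((mem_realSubdiff.1 hu y).trans (hy i)) (hnonneg i)
    rw [← show γ i • u = g i from hgu, real_inner_smul_left, PiLp.sub_apply]
    linarith [hcompl i]
  have hstat := mem_realSubdiff.1 hξ y
  rw [eq_neg_of_add_eq_zero_left hsum, inner_neg_left, sum_inner] at hstat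
  rw [inner_eq_sum_mul]
  linarith [Finset.sum_le_sum fun i (_ : i ∈ Finset.univ) => hterm i]

theorem mul_sum_le_of_neg_mem_convexSubdiff_valueFn (hx : valueFn l P r = l x)
    (hγ : -γ ∈ convexSubdiff (valueFn l P) r) {y : Vec n} {δ : ℝ} (hy : ∀ i, P i y + δ ≤ r i) :
    δ * ∑ i, γ i ≤ l y - l x := by
  have hle := (neg_mem_convexSubdiff_valueFn_iff hx).1 hγ (r - WithLp.toLp 2 fun _ => δ) y
    fun i => le_sub_iff_add_le.2 (hy i)
  rw [sub_sub_cancel_left, inner_neg_right, inner_eq_sum_mul, ← Finset.sum_mul] at hle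
  linarith

theorem le_conjugate_valueFn (hx : valueFn l P r = l x) (γ : Vec J) :
    ((-inner ℝ γ r - l x : ℝ) : EReal) ≤ conjugate (valueFn l P) (-γ) := by
  refine le_trans ?_ (le_iSup _ r)
  rw [hx, ← EReal.coe_sub, inner_neg_left]

theorem conjugate_valueFn_eq (hx : valueFn l P r = l x)
    (hγ : -γ ∈ convexSubdiff (valueFn l P) r) :
    conjugate (valueFn l P) (-γ) = ((-inner ℝ γ r - l x : ℝ) : EReal) := by
  refine le_antisymm (iSup_le fun r' => ?_) (le_conjugate_valueFn hx γ)
  refine (EReal.sub_le_sub le_rfl (hγ.2.2 r')).trans ?_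
  rw [hx, ← EReal.coe_add, ← EReal.coe_sub, EReal.coe_le_coe_iff]
  simp only [inner_neg_left, inner_sub_right]
  linarith

end ValueFunction

section LinGap

/-- The functions whose maximum with zero is `linGap l P r x γ`: the entry `none` is the linearised
value-function constraint, the entry `some i` the constraint `P i z.fst ≤ z.snd i`. -/
noncomputable def linConstraint (l : Vec n → ℝ) (P : Fin J → Vec n → ℝ) (r : Vec J) (x : Vec n)
    (γ : Vec J) : Option (Fin J) → Pt n J → ℝ
  | none, z => l z.fst - l x + inner ℝ γ (z.snd - r)
  | some i, z => P i z.fst - z.snd i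

theorem linGap_eq_posMax (r : Vec J) (x : Vec n) (γ : Vec J) (z : Pt n J) :
    linGap l P r x γ z = posMax fun o => linConstraint l P r x γ o z := by
  refine eq_of_forall_ge_iff fun t => ?_
  have hgap : linGap l P r x γ z
      = max (l z.fst - l x + inner ℝ γ (z.snd - r)) (posMax fun i => P i z.fst - z.snd i) := by
    rw [linGap, posMax, ← max_assoc, max_comm 0]
  simp only [hgap, max_le_iff, posMax_le_iff, Option.forall, linConstraint]
  tauto

theorem linGap_nonneg (r : Vec J) (x : Vec n) (γ : Vec J) (z : Pt n J) :
    0 ≤ linGap l P r x γ z :=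
  (posMax_nonneg _).trans_eq (linGap_eq_posMax r x γ z).symm

theorem linConstraint_le_linGap (r : Vec J) (x : Vec n) (γ : Vec J) (o : Option (Fin J))
    (z : Pt n J) : linConstraint l P r x γ o z ≤ linGap l P r x γ z :=
  (le_posMax _ o).trans_eq (linGap_eq_posMax r x γ z).symm

theorem convexOn_comp_fst {f : Vec n → ℝ} (hf : ConvexOn ℝ univ f) :
    ConvexOn ℝ univ fun z : Pt n J => f z.fst :=
  hf.comp_linearMap (WithLp.fstₗ 2 ℝ (Vec n) (Vec J))

theorem convexOn_linConstraint (hl : ConvexOn ℝ univ l) (hP : ∀ i, ConvexOn ℝ univ (P i))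
    (r : Vec J) (x : Vec n) (γ : Vec J) :
    ∀ o, ConvexOn ℝ univ (linConstraint l P r x γ o)
  | none => by
    refine ((convexOn_comp_fst hl).sub (concaveOn_const _ convex_univ)).add
      ⟨convex_univ, fun z _ w _ s t _ _ hst => le_of_eq ?_⟩
    obtain rfl := eq_sub_of_add_eq hst
    simp only [WithLp.add_snd, WithLp.smul_snd, inner_sub_right, inner_add_right, inner_smul_right,
      smul_eq_mul]
    ring
  | some i => (convexOn_comp_fst (hP i)).sub
      ⟨convex_univ, fun z _ w _ s t _ _ _ => le_of_eq (by simp)⟩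

theorem convexOn_linGap (hl : ConvexOn ℝ univ l) (hP : ∀ i, ConvexOn ℝ univ (P i))
    (r : Vec J) (x : Vec n) (γ : Vec J) : ConvexOn ℝ univ (linGap l P r x γ) := by
  have hconv := convexOn_posMax (convexOn_linConstraint hl hP r x γ)
  simpa only [← linGap_eq_posMax] using hconv

theorem linGap_self_eq_zero {z : Pt n J} (hz : z.fst ∈ feasible P z.snd) (γ : Vec J) :
    linGap l P z.snd z.fst γ z = 0 := by
  rw [linGap_eq_posMax]
  refine (posMax_le_iff.2 ⟨le_rfl, Option.forall.2 ⟨?_, fun i => sub_nonpos.2 (hz i)⟩⟩).antisymm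
    (posMax_nonneg _)
  simp only [linConstraint, sub_self, inner_zero_right, add_zero, le_refl]

theorem linGap_le_linGap_of_snd_eq {r r' γ : Vec J} {x x' : Vec n} (hx : valueFn l P r = l x)
    (hγ : -γ ∈ convexSubdiff (valueFn l P) r) (hx' : x' ∈ feasible P r') (γ' : Vec J) {z : Pt n J}
    (hz : z.snd = r') : linGap l P r' x' γ' z ≤ linGap l P r x γ z := by
  rw [linGap_eq_posMax r' x' γ' z]
  refine posMax_le_iff.2 ⟨linGap_nonneg r x γ z, Option.forall.2
    ⟨?_, fun i => linConstraint_le_linGap r x γ (some i) z⟩⟩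
  refine le_trans ?_ (linConstraint_le_linGap r x γ none z)
  have hle := (neg_mem_convexSubdiff_valueFn_iff hx).1 hγ r' x' hx'
  simp only [linConstraint, hz, sub_self, inner_zero_right]
  linarith

end LinGap

end Problem

theorem mem_frechetSubdiff_of_sub_sq_le {H : Type*} [NormedAddCommGroup H]
    [InnerProductSpace ℝ H] {σ : H → EReal} {x ζ : H} {e K : ℝ} (hx : σ x = e)
    (h : ∀ y, ((e + inner ℝ ζ (y - x) - K * ‖y - x‖ ^ 2 : ℝ) : EReal) ≤ σ y) :
    ζ ∈ frechetSubdiff σ x := by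
  refine ⟨hx ▸ EReal.coe_ne_top e, hx ▸ EReal.coe_ne_bot e, fun ε hε => ?_⟩
  have hsmall : ∀ᶠ y in 𝓝 x, K * ‖y - x‖ < ε :=
    (Continuous.tendsto' (by fun_prop) x 0 (by simp)).eventually_lt_const hε
  filter_upwards [hsmall] with y hy
  refine le_trans ?_ (h y)
  rw [hx, ← EReal.coe_add, EReal.coe_le_coe_iff]
  nlinarith [mul_le_mul_of_nonneg_right hy.le (norm_nonneg (y - x))]

theorem neg_half_mul_add_sq_le_mul_inner {H : Type*} [NormedAddCommGroup H]
    [InnerProductSpace ℝ H] {a m : ℝ} (hm : 0 ≤ m) (hma : m ≤ a) (u v : H) :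
    -(a / 2 * (‖u‖ ^ 2 + ‖v‖ ^ 2)) ≤ m * inner ℝ u v := by
  have hsq := norm_add_sq_real u v
  have hinner : -((‖u‖ ^ 2 + ‖v‖ ^ 2) / 2) ≤ inner ℝ u v := by
    linarith [sq_nonneg ‖u + v‖]
  calc -(a / 2 * (‖u‖ ^ 2 + ‖v‖ ^ 2)) ≤ m * -((‖u‖ ^ 2 + ‖v‖ ^ 2) / 2) := by
        nlinarith [mul_nonneg (sub_nonneg.2 hma) (add_nonneg (sq_nonneg ‖u‖) (sq_nonneg ‖v‖))]
    _ ≤ m * inner ℝ u v := by gcongr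

section Merit

variable {n J : ℕ} {L l : Vec n → ℝ} {P : Fin J → Vec n → ℝ} {ρ a : ℝ}

/-- The triple `(z, z₀, γ)` as a point of the Euclidean product. -/
noncomputable def mkTriple (z z₀ : Pt n J) (γ : Vec J) : Triple n J :=
  WithLp.toLp 2 (z, WithLp.toLp 2 (z₀, γ))

theorem inner_mkTriple (u v : Pt n J) (g : Vec J) (w : Triple n J) :
    inner ℝ (mkTriple u v g) w = inner ℝ u w.fst + inner ℝ v w.snd.fst + inner ℝ g w.snd.snd := by
  rw [add_assoc]
  exact (WithLp.prod_inner_apply (mkTriple u v g) w).trans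
    (congrArg (inner ℝ u w.fst + ·) (WithLp.prod_inner_apply (mkTriple u v g).snd w.snd))

theorem norm_sq_triple (w : Triple n J) :
    ‖w‖ ^ 2 = ‖w.fst‖ ^ 2 + ‖w.snd.fst‖ ^ 2 + ‖w.snd.snd‖ ^ 2 := by
  rw [add_assoc, WithLp.prod_norm_sq_eq_of_L2 w, WithLp.prod_norm_sq_eq_of_L2 w.snd]

theorem norm_mkTriple_le (u v : Pt n J) (g : Vec J) : ‖mkTriple u v g‖ ≤ ‖u‖ + ‖v‖ + ‖g‖ := by
  have hsq : ‖mkTriple u v g‖ ^ 2 = ‖u‖ ^ 2 + ‖v‖ ^ 2 + ‖g‖ ^ 2 := norm_sq_triple _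
  refine le_of_sq_le_sq ?_ (by positivity)
  have huv := mul_nonneg (norm_nonneg u) (norm_nonneg v)
  have hug := mul_nonneg (norm_nonneg u) (norm_nonneg g)
  have hvg := mul_nonneg (norm_nonneg v) (norm_nonneg g)
  linarith

theorem coe_linGap (r : Vec J) (x : Vec n) (γ : Vec J) (z : Pt n J) :
    (linGap l P r x γ z : EReal) =
      max (max 0 (((l z.fst + inner ℝ γ z.snd : ℝ) : EReal) + ((-inner ℝ γ r - l x : ℝ) : EReal)))
        (⨆ i, ((P i z.fst - z.snd i : ℝ) : EReal)) := by
  have hentry : l z.fst - l x + inner ℝ γ (z.snd - r)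
      = l z.fst + inner ℝ γ z.snd + (-inner ℝ γ r - l x) := by
    rw [inner_sub_right]
    ring
  rw [linGap_eq_posMax, coe_posMax, iSup_option, ← EReal.coe_add, max_assoc, ← hentry]
  rfl

theorem merit_eq {r : Vec J} {x : Vec n} (hx : valueFn l P r = l x) {w : Triple n J}
    (hw : w.fst ∈ sigmaSet n J) (hγ : -w.snd.snd ∈ convexSubdiff (valueFn l P) r) :
    merit L l P ρ a w = ((L w.fst.fst + ρ / 4 * ‖w.fst - w.snd.fst‖ ^ 2
      + a * linGap l P r x w.snd.snd w.fst : ℝ) : EReal) := by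
  rw [EReal.coe_add _ (a * _), EReal.coe_mul, coe_linGap, ← conjugate_valueFn_eq hx hγ]
  simp only [merit, indicatorFn, hw, iInf_pos, add_zero]

theorem coe_le_merit (ha : 0 ≤ a) {r : Vec J} {x : Vec n} (hx : valueFn l P r = l x)
    {w : Triple n J} (hw : w.fst ∈ sigmaSet n J) :
    ((L w.fst.fst + ρ / 4 * ‖w.fst - w.snd.fst‖ ^ 2
      + a * linGap l P r x w.snd.snd w.fst : ℝ) : EReal) ≤ merit L l P ρ a w := by
  rw [EReal.coe_add _ (a * _), EReal.coe_mul, coe_linGap]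
  simp only [merit, indicatorFn, hw, iInf_pos, add_zero]
  have := EReal.coe_nonneg.2 ha
  gcongr
  exact le_conjugate_valueFn hx _

theorem merit_eq_top_of_notMem (ha : 0 ≤ a) {w : Triple n J} (hw : w.fst ∉ sigmaSet n J) :
    merit L l P ρ a w = ⊤ := by
  simp only [merit, indicatorFn, hw, not_false_eq_true, iInf_neg, EReal.coe_add_top]
  refine EReal.top_add_of_ne_bot (ne_bot_of_le_ne_bot (b := 0) EReal.zero_ne_bot ?_)
  exact mul_nonneg (EReal.coe_nonneg.2 ha) (le_max_of_le_left (le_max_left _ _))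

section SubObjective

variable {zk zb ξ : Pt n J} {x : Vec n} {γ : Vec J}

theorem convexOn_add_mul_linGap (hL : ConvexOn ℝ univ L) (hl : ConvexOn ℝ univ l)
    (hP : ∀ i, ConvexOn ℝ univ (P i)) (ha : 0 ≤ a) (r : Vec J) (x : Vec n) (γ : Vec J) :
    ConvexOn ℝ univ fun z : Pt n J => L z.fst + a * linGap l P r x γ z :=
  (convexOn_comp_fst hL).add ((convexOn_linGap hl hP r x γ).smul ha)

theorem subObjective_eq (z : Pt n J) : subObjective L l P ρ a zk x γ z
    = L z.fst + a * linGap l P zk.snd x γ z + ρ / 2 * ‖z - zk‖ ^ 2 :=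
  add_right_comm _ _ _

theorem convexOn_subObjective (hL : ConvexOn ℝ univ L) (hl : ConvexOn ℝ univ l)
    (hP : ∀ i, ConvexOn ℝ univ (P i)) (hρ : 0 ≤ ρ) (ha : 0 ≤ a) :
    ConvexOn ℝ univ (subObjective L l P ρ a zk x γ) := by
  rw [funext subObjective_eq]
  have hprox : ConvexOn ℝ univ fun z => dist z zk ^ 2 :=
    (convexOn_dist zk convex_univ).pow (fun _ _ => dist_nonneg) 2
  simp only [dist_eq_norm] at hprox
  exact (convexOn_add_mul_linGap hL hl hP ha _ _ _).add (hprox.smul (by positivity))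

theorem sub_smul_mem_realSubdiff_of_subObjective (hL : ConvexOn ℝ univ L)
    (hl : ConvexOn ℝ univ l) (hP : ∀ i, ConvexOn ℝ univ (P i)) (ha : 0 ≤ a)
    (hξ : ξ ∈ realSubdiff (subObjective L l P ρ a zk x γ) zb) :
    ξ - ρ • (zb - zk) ∈ realSubdiff (fun z => L z.fst + a * linGap l P zk.snd x γ z) zb := by
  rw [funext subObjective_eq] at hξ
  exact sub_smul_mem_realSubdiff (convexOn_add_mul_linGap hL hl hP ha _ _ _) hξ

theorem exists_mem_posMaxMultipliers_linConstraint (hL : ConvexOn ℝ univ L)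
    (hl : ConvexOn ℝ univ l) (hP : ∀ i, ConvexOn ℝ univ (P i)) (ha : 0 ≤ a)
    (hξ : ξ ∈ realSubdiff (subObjective L l P ρ a zk x γ) zb) :
    ∃ lam ∈ posMaxMultipliers a (fun o => linConstraint l P zk.snd x γ o zb), ∀ z : Pt n J,
      L zb.fst + a * linGap l P zk.snd x γ zb + inner ℝ (ξ - ρ • (zb - zk)) (z - zb)
        ≤ L z.fst + ∑ o, lam o * linConstraint l P zk.snd x γ o z := by
  have hprox := sub_smul_mem_realSubdiff_of_subObjective hL hl hP ha hξ
  simp only [linGap_eq_posMax] at hprox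
  obtain ⟨lam, hlam, hmem⟩ := exists_mem_posMaxMultipliers (convexOn_comp_fst hL)
    (convexOn_linConstraint hl hP zk.snd x γ) ha hprox
  refine ⟨lam, hlam, fun z => ?_⟩
  have hz := mem_realSubdiff.1 hmem z
  simp only [Pi.add_apply, Finset.sum_apply, Pi.smul_apply, smul_eq_mul, hlam.2.2] at hz
  rwa [linGap_eq_posMax]

theorem add_mul_linGap_add_mul_sq_le (hL : ConvexOn ℝ univ L) (hl : ConvexOn ℝ univ l)
    (hP : ∀ i, ConvexOn ℝ univ (P i)) (ha : 0 ≤ a) {ξ₁ ξ₂ : Pt n J}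
    (hξ₁ : ξ₁ ∈ realSubdiff (subObjective L l P ρ a zk x γ) zb)
    (hξ₂ : ξ₂ ∈ normalCone (sigmaSet n J) zb) (hzk : zk ∈ sigmaSet n J) :
    L zb.fst + a * linGap l P zk.snd x γ zb + ρ * ‖zb - zk‖ ^ 2
      ≤ L zk.fst + a * linGap l P zk.snd x γ zk + ‖ξ₁ + ξ₂‖ * ‖zb - zk‖ := by
  have hstat := mem_realSubdiff.1 (sub_smul_mem_realSubdiff_of_subObjective hL hl hP ha hξ₁) zk
  have hnormal : inner ℝ ξ₂ (zk - zb) ≤ 0 := hξ₂.2 zk hzk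
  have hcauchy := real_inner_le_norm (ξ₁ + ξ₂) (zb - zk)
  rw [← neg_sub zb zk, inner_neg_right] at hstat hnormal
  rw [inner_sub_left, real_inner_smul_left, real_inner_self_eq_norm_sq] at hstat
  rw [inner_add_left] at hcauchy
  linarith

end SubObjective

theorem sum_mul_linConstraint_add_le {lam : Option (Fin J) → ℝ} {r γ : Vec J} {x : Vec n}
    {zb : Pt n J} (hlam : lam ∈ posMaxMultipliers a fun o => linConstraint l P r x γ o zb)
    (γ' : Vec J) (z : Pt n J) :
    ∑ o, lam o * linConstraint l P r x γ o z + lam none * inner ℝ (γ' - γ) (z.snd - r)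
      ≤ a * linGap l P r x γ' z := by
  rw [linGap_eq_posMax]
  refine le_of_eq_of_le ?_ (sum_mul_le_of_mem_posMaxMultipliers hlam _)
  simp only [Fintype.sum_option, linConstraint, inner_sub_left]
  ring

-- Only the coupling `⟨γ' - γ, r - rk⟩` is not convex in `(z, γ')`; it costs the quadratic term.
theorem subgradient_sub_sq_le_merit {zb zk : Pt n J} {x : Vec n} {γ : Vec J} {ξ₁ ξ₂ : Pt n J}
    {lam : Option (Fin J) → ℝ} (hρ : 0 ≤ ρ)
    (hlam : lam ∈ posMaxMultipliers a fun o => linConstraint l P zk.snd x γ o zb)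
    (hξ₁ : ∀ z : Pt n J, L zb.fst + a * linGap l P zk.snd x γ zb
      + inner ℝ (ξ₁ - ρ • (zb - zk)) (z - zb)
        ≤ L z.fst + ∑ o, lam o * linConstraint l P zk.snd x γ o z)
    (hξ₂ : ξ₂ ∈ normalCone (sigmaSet n J) zb) {z : Pt n J} (hz : z ∈ sigmaSet n J) (z₀ : Pt n J)
    (γ' : Vec J) :
    L zb.fst + ρ / 4 * ‖zb - zk‖ ^ 2 + a * linGap l P zk.snd x γ zb
      + (inner ℝ (ξ₁ + ξ₂ - (ρ / 2) • (zb - zk)) (z - zb)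
        + inner ℝ (-(ρ / 2) • (zb - zk)) (z₀ - zk)
        + inner ℝ (lam none • (zb.snd - zk.snd)) (γ' - γ))
      - a / 2 * (‖z - zb‖ ^ 2 + ‖z₀ - zk‖ ^ 2 + ‖γ' - γ‖ ^ 2)
    ≤ L z.fst + ρ / 4 * ‖z - z₀‖ ^ 2 + a * linGap l P zk.snd x γ' z := by
  have hpenalty := sum_mul_linConstraint_add_le hlam γ' z
  have hstat := hξ₁ z
  have hnormal : inner ℝ ξ₂ (z - zb) ≤ 0 := hξ₂.2 z hz
  have hprox : ‖zb - zk‖ ^ 2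
      + 2 * (inner ℝ (zb - zk) (z - zb) - inner ℝ (zb - zk) (z₀ - zk)) ≤ ‖z - z₀‖ ^ 2 := by
    have hsum : z - z₀ = (zb - zk) + (z - zb - (z₀ - zk)) := by abel
    rw [hsum, norm_add_sq_real, ← inner_sub_right]
    linarith [sq_nonneg ‖z - zb - (z₀ - zk)‖]
  have hm := le_of_mem_posMaxMultipliers hlam none
  have ha := (hlam.1 none).trans hm
  have hbilinear : -(a / 2 * (‖γ' - γ‖ ^ 2 + ‖z - zb‖ ^ 2))
      + lam none * inner ℝ (γ' - γ) (zb.snd - zk.snd)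
      ≤ lam none * inner ℝ (γ' - γ) (z.snd - zk.snd) := by
    have hle : ‖(z - zb).snd‖ ≤ ‖z - zb‖ := WithLp.norm_snd_le _ (z - zb)
    have hcross := neg_half_mul_add_sq_le_mul_inner (hlam.1 none) hm (γ' - γ) (z - zb).snd
    have hsplit : z.snd - zk.snd = (z - zb).snd + (zb.snd - zk.snd) :=
      (sub_add_sub_cancel z.snd zb.snd zk.snd).symm
    have hsq : a / 2 * ‖(z - zb).snd‖ ^ 2 ≤ a / 2 * ‖z - zb‖ ^ 2 := by gcongr
    rw [hsplit, inner_add_right]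
    linarith
  have hprox' := mul_le_mul_of_nonneg_left hprox (by positivity : 0 ≤ ρ / 4)
  have hz₀ : 0 ≤ a / 2 * ‖z₀ - zk‖ ^ 2 := by positivity
  rw [inner_sub_left, real_inner_smul_left] at hstat
  rw [inner_sub_left, inner_add_left, real_inner_smul_left, real_inner_smul_left,
    real_inner_smul_left, real_inner_comm (γ' - γ)]
  linarith

theorem exists_mem_frechetSubdiff_merit (hL : ConvexOn ℝ univ L) (hl : ConvexOn ℝ univ l)
    (hP : ∀ i, ConvexOn ℝ univ (P i)) (hρ : 0 ≤ ρ) (ha : 0 ≤ a) {zb zk : Pt n J} {x : Vec n}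
    {γ : Vec J} (hx : valueFn l P zk.snd = l x) (hγ : -γ ∈ convexSubdiff (valueFn l P) zk.snd)
    {ξ₁ ξ₂ : Pt n J} (hξ₁ : ξ₁ ∈ realSubdiff (subObjective L l P ρ a zk x γ) zb)
    (hξ₂ : ξ₂ ∈ normalCone (sigmaSet n J) zb) :
    ∃ ζ ∈ frechetSubdiff (merit L l P ρ a) (mkTriple zb zk γ),
      ‖ζ‖ ≤ ‖ξ₁ + ξ₂‖ + (ρ + a) * ‖zb - zk‖ := by
  obtain ⟨lam, hlam, hstat⟩ := exists_mem_posMaxMultipliers_linConstraint hL hl hP ha hξ₁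
  refine ⟨mkTriple (ξ₁ + ξ₂ - (ρ / 2) • (zb - zk)) (-(ρ / 2) • (zb - zk))
    (lam none • (zb.snd - zk.snd)),
    mem_frechetSubdiff_of_sub_sq_le (K := a / 2) (merit_eq hx (w := mkTriple zb zk γ) hξ₂.1 hγ)
      fun w => ?_, ?_⟩
  · by_cases hw : w.fst ∈ sigmaSet n J
    · refine le_trans (EReal.coe_le_coe_iff.2 ?_) (coe_le_merit ha hx hw)
      rw [norm_sq_triple, inner_mkTriple]
      exact subgradient_sub_sq_le_merit hρ hlam hstat hξ₂ hw w.snd.fst w.snd.snd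
    · exact (merit_eq_top_of_notMem ha hw).symm ▸ le_top
  · have hsnd : ‖zb.snd - zk.snd‖ ≤ ‖zb - zk‖ := WithLp.norm_snd_le _ (zb - zk)
    have hmul : lam none * ‖zb.snd - zk.snd‖ ≤ a * ‖zb - zk‖ :=
      mul_le_mul (le_of_mem_posMaxMultipliers hlam none) hsnd (norm_nonneg _) ha
    have hnorm := norm_mkTriple_le (ξ₁ + ξ₂ - (ρ / 2) • (zb - zk)) (-(ρ / 2) • (zb - zk))
      (lam none • (zb.snd - zk.snd))
    have hsub := norm_sub_le (ξ₁ + ξ₂) ((ρ / 2) • (zb - zk))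
    have hhalf : ‖(ρ / 2) • (zb - zk)‖ = ρ / 2 * ‖zb - zk‖ :=
      norm_smul_of_nonneg (by positivity) _
    have hneg : ‖-(ρ / 2) • (zb - zk)‖ = ρ / 2 * ‖zb - zk‖ := by
      rw [neg_smul, norm_neg, hhalf]
    rw [norm_smul_of_nonneg (hlam.1 none)] at hnorm
    linarith

end Merit

/-! ### Finite length from the Kurdyka–Łojasiewicz inequality -/

/-- `φ` is nonnegative on `[0, η)` and `ψ ≥ 0` bounds its backward slopes from below, as the
derivative of a nondecreasing concave function does.  Unlike concavity with a derivative, the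
notion is stable under pointwise sums, which is what a covering argument needs. -/
structure HasSlopeBound (η : ℝ) (φ ψ : ℝ → ℝ) : Prop where
  nonneg : ∀ s, 0 ≤ s → s < η → 0 ≤ φ s
  slope_nonneg : ∀ s, 0 < s → s < η → 0 ≤ ψ s
  slope_le : ∀ s t, 0 ≤ t → t < s → s < η → ψ s * (s - t) ≤ φ s - φ t

theorem HasSlopeBound.mono {η η' : ℝ} {φ ψ : ℝ → ℝ} (h : HasSlopeBound η φ ψ) (hη : η' ≤ η) :
    HasSlopeBound η' φ ψ where
  nonneg s hs hsη := h.nonneg s hs (hsη.trans_le hη)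
  slope_nonneg s hs hsη := h.slope_nonneg s hs (hsη.trans_le hη)
  slope_le s t ht hts hsη := h.slope_le s t ht hts (hsη.trans_le hη)

theorem HasSlopeBound.add {η : ℝ} {φ ψ φ' ψ' : ℝ → ℝ} (h : HasSlopeBound η φ ψ)
    (h' : HasSlopeBound η φ' ψ') : HasSlopeBound η (φ + φ') (ψ + ψ') where
  nonneg s hs hsη := add_nonneg (h.nonneg s hs hsη) (h'.nonneg s hs hsη)
  slope_nonneg s hs hsη := add_nonneg (h.slope_nonneg s hs hsη) (h'.slope_nonneg s hs hsη)
  slope_le s t ht hts hsη := by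
    simp only [Pi.add_apply]
    linarith [h.slope_le s t ht hts hsη, h'.slope_le s t ht hts hsη]

theorem IsDesingularizing.hasSlopeBound {η : EReal} {η' : ℝ} {φ : ℝ → ℝ}
    (h : IsDesingularizing η φ) (hη : (η' : EReal) ≤ η) : HasSlopeBound η' φ (deriv φ) := by
  have hlt {s : ℝ} (hs : s < η') : (s : EReal) < η := (EReal.coe_lt_coe_iff.2 hs).trans_le hη
  refine ⟨fun s h0 hs => h.nonneg s h0 (hlt hs), fun s h0 hs => (h.deriv_pos s h0 (hlt hs)).le,
    fun s t ht hts hs => ?_⟩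
  have hs0 := ht.trans_lt hts
  have hslope := h.concave.deriv_le_slope ⟨ht, hlt (hts.trans hs)⟩ ⟨hs0.le, hlt hs⟩ hts
    (differentiableAt_of_deriv_ne_zero (h.deriv_pos s hs0 (hlt hs)).ne')
  rwa [slope_def_field, le_div_iff₀ (sub_pos.2 hts)] at hslope

section KL

variable {H : Type*} [NormedAddCommGroup H] [InnerProductSpace ℝ H] {σ : H → EReal}

/-- The Kurdyka–Łojasiewicz inequality for `σ` above the level `e'`, at all points of `Y` with one
common pair of functions `φ`, `ψ` in the roles of the desingularizing function and its
derivative. -/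
def KLInequalityOn (σ : H → EReal) (e' : ℝ) (Y : Set H) : Prop :=
  ∃ η > 0, ∃ φ ψ : ℝ → ℝ, HasSlopeBound η φ ψ ∧
    ∀ y ∈ Y, ∀ e : ℝ, σ y = e → e' < e → e < e' + η →
      ∀ ζ ∈ limitingSubdiff σ y, 1 ≤ ψ (e - e') * ‖ζ‖

theorem klInequalityOn_empty (σ : H → EReal) (e' : ℝ) : KLInequalityOn σ e' ∅ :=
  ⟨1, one_pos, 0, 0, ⟨fun _ _ _ => le_rfl, fun _ _ _ => le_rfl, by simp⟩, by simp⟩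

theorem KLInequalityOn.union {e' : ℝ} {Y Y' : Set H} (h : KLInequalityOn σ e' Y)
    (h' : KLInequalityOn σ e' Y') : KLInequalityOn σ e' (Y ∪ Y') := by
  obtain ⟨η, hη, φ, ψ, hb, hKL⟩ := h
  obtain ⟨η', hη', φ', ψ', hb', hKL'⟩ := h'
  refine ⟨min η η', lt_min hη hη', φ + φ', ψ + ψ',
    (hb.mono (min_le_left _ _)).add (hb'.mono (min_le_right _ _)), ?_⟩
  intro y hy e he hlt hlt' ζ hζ
  obtain ⟨hltη, hltη'⟩ := lt_min_iff.1 (sub_lt_iff_lt_add'.2 hlt')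
  have hψ := mul_nonneg (hb.slope_nonneg _ (sub_pos.2 hlt) hltη) (norm_nonneg ζ)
  have hψ' := mul_nonneg (hb'.slope_nonneg _ (sub_pos.2 hlt) hltη') (norm_nonneg ζ)
  rw [Pi.add_apply, add_mul]
  rcases hy with hy | hy
  · linarith [hKL y hy e he hlt (sub_lt_iff_lt_add'.1 hltη) ζ hζ]
  · linarith [hKL' y hy e he hlt (sub_lt_iff_lt_add'.1 hltη') ζ hζ]

theorem HasKLAt.exists_klInequalityOn {x : H} {e' : ℝ} (h : HasKLAt σ x) (hx : σ x = e') :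
    ∃ Y ∈ 𝓝 x, KLInequalityOn σ e' Y := by
  obtain ⟨η, hη, Y, hY, φ, hφ, hKL⟩ := h
  obtain ⟨η', hη'0, hη'η⟩ := EReal.lt_iff_exists_real_btwn.1 hη
  have hb := hφ.hasSlopeBound hη'η.le
  refine ⟨Y, hY, η', EReal.coe_pos.1 hη'0, φ, deriv φ, hb, ?_⟩
  intro y hy e he hlt hlt' ζ hζ
  have hdist : Metric.infEDist 0 (limitingSubdiff σ y) ≤ ENNReal.ofReal ‖ζ‖ :=
    (Metric.infEDist_le_edist_of_mem hζ).trans_eq (by rw [edist_dist, dist_zero_left])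
  have hup : (e : EReal) < e' + η := by
    refine (EReal.coe_lt_coe_iff.2 hlt').trans_le ?_
    rw [EReal.coe_add]
    gcongr
  have hKLy := hKL y hy (by rwa [hx, he, EReal.coe_lt_coe_iff]) (by rwa [hx, he])
  rw [he, hx, ← EReal.coe_sub, EReal.toReal_coe] at hKLy
  have hone := hKLy.trans (mul_le_mul_right hdist _)
  rwa [← ENNReal.ofReal_mul (hb.slope_nonneg _ (sub_pos.2 hlt) (sub_lt_iff_lt_add'.2 hlt')),
    ENNReal.one_le_ofReal] at hone

theorem exists_mem_nhdsSet_klInequalityOn {K : Set H} (hK : IsCompact K) {e' : ℝ}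
    (h : ∀ y ∈ K, σ y = e' ∧ HasKLAt σ y) : ∃ U ∈ 𝓝ˢ K, KLInequalityOn σ e' U := by
  refine hK.induction_on (p := fun S => ∃ U ∈ 𝓝ˢ S, KLInequalityOn σ e' U) ?_ ?_ ?_ ?_
  · exact ⟨∅, by simp, klInequalityOn_empty σ e'⟩
  · rintro S T hST ⟨U, hU, hKL⟩
    exact ⟨U, nhdsSet_mono hST hU, hKL⟩
  · rintro S T ⟨U, hU, hKL⟩ ⟨V, hV, hKL'⟩
    exact ⟨U ∪ V, union_mem_nhdsSet hU hV, hKL.union hKL'⟩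
  · intro y hy
    obtain ⟨Y, hY, hKL⟩ := (h y hy).2.exists_klInequalityOn (h y hy).1
    exact ⟨interior Y, mem_nhdsWithin_of_mem_nhds (interior_mem_nhds.2 hY), Y,
      subset_interior_iff_mem_nhdsSet.1 le_rfl, hKL⟩

theorem frechetSubdiff_subset_limitingSubdiff (σ : H → EReal) (x : H) :
    frechetSubdiff σ x ⊆ limitingSubdiff σ x := fun ζ hζ =>
  ⟨hζ.1, hζ.2.1, fun _ => x, fun _ => ζ, fun _ => hζ, tendsto_const_nhds, tendsto_const_nhds,
    tendsto_const_nhds⟩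

end KL

theorem summable_of_le_quarter_add_sub {D V : ℕ → ℝ} (hD : ∀ k, 0 ≤ D k) (hV : ∀ k, 0 ≤ V k)
    (h : ∀ k, D (k + 2) ≤ (D k + D (k + 1)) / 4 + (V k - V (k + 1))) : Summable D := by
  -- `W` is the potential that absorbs the two earlier terms of the recursion.
  let W : ℕ → ℝ := fun k => D (k + 1) / 2 + D k / 4 + V k
  have hsum (m : ℕ) : ∑ k ∈ Finset.range m, D (k + 2) ≤ 2 * (W 0 - W m) := by
    induction m with
    | zero => simp
    | succ m ih =>
      rw [Finset.sum_range_succ]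
      simp only [W] at ih ⊢
      linarith [h m]
  have hW (m : ℕ) : 0 ≤ W m := by
    have h0 := hD m
    have h1 := hD (m + 1)
    have hVm := hV m
    positivity
  exact (summable_nat_add_iff 2).1 (summable_of_sum_range_le (c := 2 * W 0) (fun k => hD _)
    fun m => (hsum m).trans (by linarith [hW m]))

-- Multiply the decrease by the KL inequality, then split `√(X Y) ≤ X / 4 + Y`.
theorem le_quarter_add_of_mul_sq_le {a b d p q s X : ℝ} (ha : 0 < a) (hb : 0 ≤ b) (hX : 0 ≤ X)
    (hs : 0 ≤ s) (hq : 0 ≤ q) (hdec : a * d ^ 2 ≤ p) (hslope : s * p ≤ q)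
    (hKL : 1 ≤ s * (b * X)) : d ≤ X / 4 + b / a * q := by
  have hprod : a * d ^ 2 ≤ b * X * q :=
    calc a * d ^ 2 ≤ a * d ^ 2 * (s * (b * X)) := le_mul_of_one_le_right (by positivity) hKL
      _ = b * X * (s * (a * d ^ 2)) := by ring
      _ ≤ b * X * (s * p) := by gcongr
      _ ≤ b * X * q := by gcongr
  have hsq : d ^ 2 ≤ X * (b / a * q) := by
    rw [show X * (b / a * q) = b * X * q / a by ring, le_div_iff₀ ha]
    linarith
  refine (abs_le_of_sq_le_sq' ?_ (by positivity)).2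
  linarith [sq_nonneg (X / 4 - b / a * q)]

theorem HasSlopeBound.summable_of_descent {D e : ℕ → ℝ} {a b e' η : ℝ} {φ ψ : ℝ → ℝ}
    (hφ : HasSlopeBound η φ ψ) (ha : 0 < a) (hb : 0 ≤ b) (hη : 0 < η) (hD : ∀ k, 0 ≤ D k)
    (hdec : ∀ k, a * D (k + 2) ^ 2 ≤ e k - e (k + 1)) (hlim : Tendsto e atTop (𝓝 e'))
    (hKL : ∀ᶠ k in atTop, e' < e k → e k < e' + η →
      1 ≤ ψ (e k - e') * (b * (D k + D (k + 1)))) : Summable D := by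
  have hanti : Antitone e := antitone_nat_of_succ_le fun k =>
    sub_nonneg.1 ((by positivity : 0 ≤ a * D (k + 2) ^ 2).trans (hdec k))
  have hge (k : ℕ) : 0 ≤ e k - e' := sub_nonneg.2 (hanti.le_of_tendsto hlim k)
  obtain ⟨N, hN⟩ := eventually_atTop.1
    (hKL.and (hlim.eventually_lt_const (lt_add_of_pos_right e' hη)))
  have hlt {k : ℕ} (hk : N ≤ k) : e k - e' < η := sub_lt_iff_lt_add'.2 (hN k hk).2
  have hstep {k : ℕ} (hk : N ≤ k) : D (k + 2) ≤ (D k + D (k + 1)) / 4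
      + b / a * (φ (e k - e') - φ (e (k + 1) - e')) := by
    have hX : 0 ≤ D k + D (k + 1) := add_nonneg (hD _) (hD _)
    rcases (hanti (Nat.le_succ k)).eq_or_lt with heq | hdrop
    · have hsq : a * D (k + 2) ^ 2 ≤ 0 := (hdec k).trans_eq (sub_eq_zero.2 heq.symm)
      have hzero : D (k + 2) = 0 :=
        pow_eq_zero_iff two_ne_zero |>.1
          ((nonpos_of_mul_nonpos_right hsq ha).antisymm (sq_nonneg _))
      rw [show e (k + 1) = e k from heq, sub_self, mul_zero, hzero]
      linarith
    · have hpos : 0 < e k - e' := (hge (k + 1)).trans_lt (sub_lt_sub_right hdrop e')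
      have hψ := hφ.slope_nonneg _ hpos (hlt hk)
      have hslope := hφ.slope_le _ _ (hge (k + 1)) (sub_lt_sub_right hdrop e') (hlt hk)
      rw [sub_sub_sub_cancel_right] at hslope
      exact le_quarter_add_of_mul_sq_le ha hb hX hψ
        ((mul_nonneg hψ (sub_nonneg.2 hdrop.le)).trans hslope) (hdec k) hslope
        ((hN k hk).1 (sub_pos.1 hpos) (hN k hk).2)
  refine (summable_nat_add_iff N).1 (summable_of_le_quarter_add_sub
    (V := fun k => b / a * φ (e (k + N) - e')) (fun k => hD _) (fun k => ?_) fun k => ?_)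
  · exact mul_nonneg (by positivity) (hφ.nonneg _ (hge _) (hlt (Nat.le_add_left N k)))
  · rw [← mul_sub, add_right_comm k 2, add_right_comm k 1]
    exact hstep (Nat.le_add_left N k)

theorem tendsto_zero_of_mul_sq_le_sub {D e : ℕ → ℝ} {a e' : ℝ} (ha : 0 < a) (hD : ∀ k, 0 ≤ D k)
    (hdec : ∀ k, a * D k ^ 2 ≤ e k - e (k + 1)) (hlim : Tendsto e atTop (𝓝 e')) :
    Tendsto D atTop (𝓝 0) := by
  have hdiff : Tendsto (fun k => (e k - e (k + 1)) / a) atTop (𝓝 0) := by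
    simpa using (hlim.sub ((tendsto_add_atTop_iff_nat 1).2 hlim)).div_const a
  have hsq : Tendsto (fun k => D k ^ 2) atTop (𝓝 0) :=
    squeeze_zero (fun k => sq_nonneg _)
      (fun k => (le_div_iff₀ ha).2 ((mul_comm _ _).trans_le (hdec k))) hdiff
  simpa [Real.sqrt_sq (hD _)] using hsq.sqrt

theorem IsKLFunction.summable_of_descent {H : Type*} [NormedAddCommGroup H]
    [InnerProductSpace ℝ H] [ProperSpace H] {σ : H → EReal} (hσ : IsKLFunction σ) {w : ℕ → H}
    (hw : Bornology.IsBounded (range w)) {D e : ℕ → ℝ} {a b e' : ℝ} (ha : 0 < a) (hb : 0 ≤ b)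
    (hD : ∀ k, 0 ≤ D k) (he : ∀ k, σ (w k) = e k)
    (hdec : ∀ k, a * D (k + 2) ^ 2 ≤ e k - e (k + 1)) (hlim : Tendsto e atTop (𝓝 e'))
    (hcl : ∀ y, MapClusterPt y atTop w → σ y = e')
    (hζ : ∀ k, ∃ ζ ∈ frechetSubdiff σ (w k), ‖ζ‖ ≤ b * (D k + D (k + 1))) : Summable D := by
  choose ζ hζmem hζle using hζ
  have hDlim : Tendsto D atTop (𝓝 0) :=
    (tendsto_add_atTop_iff_nat 2).1 (tendsto_zero_of_mul_sq_le_sub ha (fun k => hD _) hdec hlim)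
  have hζlim : Tendsto ζ atTop (𝓝 0) := by
    refine squeeze_zero_norm hζle ?_
    simpa using (hDlim.add ((tendsto_add_atTop_iff_nat 1).2 hDlim)).const_mul b
  have hcrit (y : H) (hy : MapClusterPt y atTop w) : (0 : H) ∈ limitingSubdiff σ y := by
    obtain ⟨u, hu, hwu⟩ := hy.tendsto_subseq
    refine ⟨hcl y hy ▸ EReal.coe_ne_top e', hcl y hy ▸ EReal.coe_ne_bot e', w ∘ u, ζ ∘ u,
      fun m => hζmem (u m), hwu, ?_, hζlim.comp hu.tendsto_atTop⟩
    simp only [Function.comp_apply, he, hcl y hy]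
    exact (continuous_coe_real_ereal.tendsto e').comp (hlim.comp hu.tendsto_atTop)
  have hclosure : IsCompact (closure (range w)) := hw.isCompact_closure
  have hmem (k : ℕ) : w k ∈ closure (range w) := subset_closure (mem_range_self k)
  have hcompact : IsCompact {y | MapClusterPt y atTop w} :=
    hclosure.of_isClosed_subset isClosed_setOfPred_clusterPt fun y hy =>
      isClosed_closure.mem_of_mapClusterPt hy (Eventually.of_forall hmem)
  obtain ⟨U, hU, η, hη, φ, ψ, hφ, hKL⟩ := exists_mem_nhdsSet_klInequalityOn (σ := σ) (e' := e')
    hcompact fun y hy => ⟨hcl y hy, hσ.kl y ⟨0, hcrit y hy⟩⟩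
  have hmemU : ∀ᶠ k in atTop, w k ∈ U :=
    hclosure.tendsto_nhdsSet_of_mapClusterPt (Eventually.of_forall hmem) (fun y _ hy => hy) hU
  refine hφ.summable_of_descent ha hb hη hD hdec hlim ?_
  filter_upwards [hmemU, hlim.eventually_lt_const (lt_add_of_pos_right e' hη)] with k hk hkη hlt _
  have hψ := hφ.slope_nonneg (e k - e') (sub_pos.2 hlt) (sub_lt_iff_lt_add'.2 hkη)
  calc 1 ≤ ψ (e k - e') * ‖ζ k‖ :=
        hKL _ hk _ (he k) hlt hkη _ (frechetSubdiff_subset_limitingSubdiff σ _ (hζmem k))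
    _ ≤ ψ (e k - e') * (b * (D k + D (k + 1))) := by gcongr; exact hζle k

/-! ### Passage to the limit -/

theorem continuous_posMax {ι : Type*} [Finite ι] : Continuous (posMax : (ι → ℝ) → ℝ) := by
  have := Fintype.ofFinite ι
  exact continuous_of_convexOn_univ
    (convexOn_posMax fun i => (LinearMap.proj i).convexOn convex_univ)

theorem mem_posMaxMultipliers_of_tendsto {ι κ : Type*} [Fintype ι] {f : Filter κ} [f.NeBot]
    {c : ℝ} {u lam : κ → ι → ℝ} {u₀ lam₀ : ι → ℝ} (h : ∀ k, lam k ∈ posMaxMultipliers c (u k))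
    (hlam : Tendsto lam f (𝓝 lam₀)) (hu : Tendsto u f (𝓝 u₀)) :
    lam₀ ∈ posMaxMultipliers c u₀ := by
  rw [tendsto_pi_nhds] at hlam
  refine ⟨fun i => ge_of_tendsto' (hlam i) fun k => (h k).1 i,
    le_of_tendsto' (tendsto_finsetSum _ fun i _ => hlam i) fun k => (h k).2.1,
    tendsto_nhds_unique (tendsto_finsetSum _ fun i _ => (hlam i).mul (tendsto_pi_nhds.1 hu i)) ?_⟩
  simp only [fun k => (h k).2.2]
  exact ((continuous_posMax.tendsto u₀).comp hu).const_mul c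

section Problem

variable {n J : ℕ} {L l : Vec n → ℝ} {P : Fin J → Vec n → ℝ}

theorem continuous_comp_fst {f : Vec n → ℝ} (hf : ConvexOn ℝ univ f) :
    Continuous fun z : Pt n J => f z.fst :=
  (continuous_of_convexOn_univ hf).comp (WithLp.continuous_fst 2 _ _)

theorem isClosed_sigmaSet : IsClosed (sigmaSet n J) := by
  have h : sigmaSet n J = ⋂ i, {z | 0 ≤ z.snd i} := by
    ext z
    simp [sigmaSet, orthant]
  rw [h]
  exact isClosed_iInter fun i => isClosed_le continuous_const <|
    (EuclideanSpace.proj (𝕜 := ℝ) i).continuous.comp (WithLp.continuous_snd 2 _ _)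

section Limit

variable {κ : Type*} {f : Filter κ} {r γ : κ → Vec J} {x : κ → Vec n} {z : κ → Pt n J}
  {z₀ : Pt n J} {γ₀ : Vec J}

theorem tendsto_linConstraint (hl : ConvexOn ℝ univ l) (hP : ∀ i, ConvexOn ℝ univ (P i))
    {r₀ : Vec J} {x₀ : Vec n} (hr : Tendsto r f (𝓝 r₀))
    (hx : Tendsto (fun k => l (x k)) f (𝓝 (l x₀))) (hγ : Tendsto γ f (𝓝 γ₀))
    (hz : Tendsto z f (𝓝 z₀)) (o : Option (Fin J)) :
    Tendsto (fun k => linConstraint l P (r k) (x k) (γ k) o (z k)) f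
      (𝓝 (linConstraint l P r₀ x₀ γ₀ o z₀)) := by
  have hsnd : Tendsto (fun k => (z k).snd) f (𝓝 z₀.snd) :=
    ((WithLp.continuous_snd 2 _ _).tendsto z₀).comp hz
  have hfst {g : Vec n → ℝ} (hg : ConvexOn ℝ univ g) :
      Tendsto (fun k => g (z k).fst) f (𝓝 (g z₀.fst)) :=
    ((continuous_comp_fst hg).tendsto z₀).comp hz
  cases o with
  | none => exact ((hfst hl).sub hx).add (hγ.inner (hsnd.sub hr))
  | some i =>
    exact (hfst (hP i)).sub (((EuclideanSpace.proj (𝕜 := ℝ) i).continuous.tendsto _).comp hsnd)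

theorem mem_feasible_of_tendsto_linGap [f.NeBot] (hP : ∀ i, ConvexOn ℝ univ (P i))
    (hz : Tendsto z f (𝓝 z₀))
    (hgap : Tendsto (fun k => linGap l P (r k) (x k) (γ k) (z k)) f (𝓝 0)) :
    z₀.fst ∈ feasible P z₀.snd := fun i => by
  have hcont : Continuous fun w : Pt n J => P i w.fst - w.snd i :=
    (continuous_comp_fst (hP i)).sub <|
      (EuclideanSpace.proj (𝕜 := ℝ) i).continuous.comp (WithLp.continuous_snd 2 _ _)
  exact sub_nonpos.1 <| le_of_tendsto_of_tendsto' ((hcont.tendsto z₀).comp hz) hgap fun k =>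
    linConstraint_le_linGap (r k) (x k) (γ k) (some i) (z k)

theorem tendsto_add_inner_sub_linGap (hl : ConvexOn ℝ univ l) (hr : Tendsto r f (𝓝 z₀.snd))
    (hz : Tendsto z f (𝓝 z₀)) (hγ : Tendsto γ f (𝓝 γ₀))
    (hgap : Tendsto (fun k => linGap l P (r k) (x k) (γ k) (z k)) f (𝓝 0)) :
    Tendsto (fun k => l (z k).fst + inner ℝ (γ k) ((z k).snd - r k)
      - linGap l P (r k) (x k) (γ k) (z k)) f (𝓝 (l z₀.fst)) := by
  have hsnd : Tendsto (fun k => (z k).snd) f (𝓝 z₀.snd) :=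
    ((WithLp.continuous_snd 2 _ _).tendsto z₀).comp hz
  have hlim := ((((continuous_comp_fst hl).tendsto z₀).comp hz).add
    (hγ.inner (hsnd.sub hr))).sub hgap
  rwa [sub_self, inner_zero_right, add_zero, sub_zero] at hlim

theorem add_inner_sub_linGap_le (r γ : Vec J) (x : Vec n) (z : Pt n J) :
    l z.fst + inner ℝ γ (z.snd - r) - linGap l P r x γ z ≤ l x := by
  have hle := linConstraint_le_linGap (l := l) (P := P) r x γ none z
  simp only [linConstraint] at hle
  linarith

theorem sub_inner_le_of_tendsto_linGap [f.NeBot] (hl : ConvexOn ℝ univ l)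
    (hx : ∀ k, valueFn l P (r k) = l (x k))
    (hsub : ∀ k, -γ k ∈ convexSubdiff (valueFn l P) (r k)) (hr : Tendsto r f (𝓝 z₀.snd))
    (hz : Tendsto z f (𝓝 z₀)) (hγ : Tendsto γ f (𝓝 γ₀))
    (hgap : Tendsto (fun k => linGap l P (r k) (x k) (γ k) (z k)) f (𝓝 0)) (r' : Vec J)
    {y : Vec n} (hy : y ∈ feasible P r') : l z₀.fst - inner ℝ γ₀ (r' - z₀.snd) ≤ l y := by
  refine le_of_tendsto' ((tendsto_add_inner_sub_linGap hl hr hz hγ hgap).sub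
    (hγ.inner (tendsto_const_nhds.sub hr))) fun k => ?_
  have hlower := add_inner_sub_linGap_le (l := l) (P := P) (r k) (γ k) (x k) (z k)
  have hupper := (neg_mem_convexSubdiff_valueFn_iff (hx k)).1 (hsub k) r' y hy
  linarith

theorem mem_solutionSet_of_tendsto_linGap [f.NeBot] (hl : ConvexOn ℝ univ l)
    (hP : ∀ i, ConvexOn ℝ univ (P i)) (hx : ∀ k, valueFn l P (r k) = l (x k))
    (hsub : ∀ k, -γ k ∈ convexSubdiff (valueFn l P) (r k)) (hr : Tendsto r f (𝓝 z₀.snd))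
    (hz : Tendsto z f (𝓝 z₀)) (hγ : Tendsto γ f (𝓝 γ₀))
    (hgap : Tendsto (fun k => linGap l P (r k) (x k) (γ k) (z k)) f (𝓝 0)) :
    z₀.fst ∈ solutionSet l P z₀.snd := by
  refine ⟨mem_feasible_of_tendsto_linGap hP hz hgap, fun y hy => ?_⟩
  simpa only [sub_self, inner_zero_right, sub_zero] using
    sub_inner_le_of_tendsto_linGap hl hx hsub hr hz hγ hgap z₀.snd hy

theorem neg_mem_convexSubdiff_of_tendsto_linGap [f.NeBot] (hl : ConvexOn ℝ univ l)
    (hP : ∀ i, ConvexOn ℝ univ (P i)) (hx : ∀ k, valueFn l P (r k) = l (x k))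
    (hsub : ∀ k, -γ k ∈ convexSubdiff (valueFn l P) (r k)) (hr : Tendsto r f (𝓝 z₀.snd))
    (hz : Tendsto z f (𝓝 z₀)) (hγ : Tendsto γ f (𝓝 γ₀))
    (hgap : Tendsto (fun k => linGap l P (r k) (x k) (γ k) (z k)) f (𝓝 0)) :
    -γ₀ ∈ convexSubdiff (valueFn l P) z₀.snd :=
  (neg_mem_convexSubdiff_valueFn_iff (valueFn_eq_of_mem_solutionSet
    (mem_solutionSet_of_tendsto_linGap hl hP hx hsub hr hz hγ hgap))).2 fun r' _ hy =>
      sub_inner_le_of_tendsto_linGap hl hx hsub hr hz hγ hgap r' hy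

theorem tendsto_lower_value_of_tendsto_linGap [f.NeBot] (hl : ConvexOn ℝ univ l)
    (hP : ∀ i, ConvexOn ℝ univ (P i)) (hx : ∀ k, valueFn l P (r k) = l (x k))
    (hsub : ∀ k, -γ k ∈ convexSubdiff (valueFn l P) (r k)) (hr : Tendsto r f (𝓝 z₀.snd))
    (hz : Tendsto z f (𝓝 z₀)) (hγ : Tendsto γ f (𝓝 γ₀))
    (hgap : Tendsto (fun k => linGap l P (r k) (x k) (γ k) (z k)) f (𝓝 0)) :
    Tendsto (fun k => l (x k)) f (𝓝 (l z₀.fst)) := by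
  have hupper : Tendsto (fun k => l z₀.fst + inner ℝ (γ k) (z₀.snd - r k)) f (𝓝 (l z₀.fst)) := by
    have hlim := (hγ.inner ((tendsto_const_nhds (x := z₀.snd)).sub hr)).const_add (l z₀.fst)
    rwa [sub_self, inner_zero_right, add_zero] at hlim
  refine tendsto_of_tendsto_of_tendsto_of_le_of_le
    (tendsto_add_inner_sub_linGap hl hr hz hγ hgap) hupper
    (fun k => add_inner_sub_linGap_le _ _ _ _) fun k => ?_
  have hle := (neg_mem_convexSubdiff_valueFn_iff (hx k)).1 (hsub k) z₀.snd z₀.fst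
    (mem_feasible_of_tendsto_linGap hP hz hgap)
  exact sub_le_iff_le_add.1 hle

end Limit

section Stationary

variable {z : Pt n J} {γ : Vec J} {lam : Option (Fin J) → ℝ}

theorem zero_mem_realSubdiff_add_of_forall_le (hL : ConvexOn ℝ univ L) (hl : ConvexOn ℝ univ l)
    (hP : ∀ i, ConvexOn ℝ univ (P i)) (hz : z ∈ sigmaSet n J) (hlam : ∀ o, 0 ≤ lam o)
    (hcompl : ∀ i, lam (some i) * (P i z.fst - z.snd i) = 0)
    (hmin : ∀ y ∈ sigmaSet n J,
      L z.fst ≤ L y.fst + ∑ o, lam o * linConstraint l P z.snd z.fst γ o y) :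
    (0 : Vec n) ∈ realSubdiff L z.fst + lam none • realSubdiff l z.fst
      + ∑ i, lam (some i) • realSubdiff (P i) z.fst := by
  have hcl : ConvexOn ℝ univ (lam none • l) := hl.smul (hlam none)
  have hcP : ∀ i ∈ Finset.univ, ConvexOn ℝ univ (lam (some i) • P i) := fun i _ =>
    (hP i).smul (hlam (some i))
  simp only [← realSubdiff_const_smul hl (hlam none),
    ← realSubdiff_const_smul (hP _) (hlam (some _))]
  rw [← realSubdiff_sum _ hcP, ← realSubdiff_add hL hcl,
    ← realSubdiff_add (hL.add hcl) (convexOn_sum _ hcP), mem_realSubdiff]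
  intro x
  have hle := hmin (WithLp.toLp 2 (x, z.snd)) hz
  have hsum := Finset.sum_eq_zero fun i (_ : i ∈ Finset.univ) => hcompl i
  simp only [Fintype.sum_option, linConstraint, WithLp.toLp_fst, WithLp.toLp_snd, sub_self,
    inner_zero_right, add_zero, mul_sub, Finset.sum_sub_distrib] at hle hsum
  simp only [Pi.add_apply, Finset.sum_apply, Pi.smul_apply, smul_eq_mul, inner_zero_left, add_zero]
  linarith

theorem sub_smul_mem_normalCone_of_forall_le (hz : z ∈ sigmaSet n J)
    (hcompl : ∀ i, lam (some i) * (P i z.fst - z.snd i) = 0)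
    (hmin : ∀ y ∈ sigmaSet n J,
      L z.fst ≤ L y.fst + ∑ o, lam o * linConstraint l P z.snd z.fst γ o y) :
    (WithLp.toLp 2 fun i => lam (some i)) - lam none • γ ∈ normalCone (orthant J) z.snd := by
  refine ⟨hz, fun r hr => ?_⟩
  have hle := hmin (WithLp.toLp 2 (z.fst, r)) hr
  have hsum := Finset.sum_eq_zero fun i (_ : i ∈ Finset.univ) => hcompl i
  simp only [Fintype.sum_option, linConstraint, WithLp.toLp_fst, WithLp.toLp_snd, sub_self,
    zero_add, mul_sub, Finset.sum_sub_distrib] at hle hsum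
  rw [inner_sub_left, real_inner_smul_left, inner_eq_sum_mul (WithLp.toLp 2 _)]
  simp only [PiLp.sub_apply, mul_sub, Finset.sum_sub_distrib]
  linarith

theorem isKKTStationary_of_forall_le (hL : ConvexOn ℝ univ L) (hl : ConvexOn ℝ univ l)
    (hP : ∀ i, ConvexOn ℝ univ (P i)) {a : ℝ} (hz : z ∈ sigmaSet n J)
    (hx : z.fst ∈ solutionSet l P z.snd) (hγ : -γ ∈ convexSubdiff (valueFn l P) z.snd)
    (hlam : lam ∈ posMaxMultipliers a fun o => linConstraint l P z.snd z.fst γ o z)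
    (hmin : ∀ y ∈ sigmaSet n J,
      L z.fst ≤ L y.fst + ∑ o, lam o * linConstraint l P z.snd z.fst γ o y) :
    IsKKTStationary L l P z := by
  have hcompl (i : Fin J) : lam (some i) * (P i z.fst - z.snd i) = 0 := by
    have h := mul_posMax_sub_eq_zero_of_mem_posMaxMultipliers hlam (some i)
    rwa [← linGap_eq_posMax, linGap_self_eq_zero hx.1, zero_sub, mul_neg, neg_eq_zero] at h
  exact ⟨hz, (valueFn_eq_of_mem_solutionSet hx).ge, hx.1, lam none,
    WithLp.toLp 2 fun i => lam (some i), hlam.1 none, fun i => hlam.1 (some i),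
    zero_mem_realSubdiff_add_of_forall_le hL hl hP hz hlam.1 hcompl hmin,
    mem_add.2 ⟨-lam none • -γ, smul_mem_smul_set hγ, _,
      sub_smul_mem_normalCone_of_forall_le hz hcompl hmin, by
        rw [neg_smul_neg, add_sub_cancel]⟩, hcompl⟩

end Stationary

end Problem

/-! ### Runs with constant penalty -/

theorem le_div_of_ofReal_div_le_max {a c D t : ℝ} (hc : 0 < c) (ha : 0 ≤ a) (hD : 0 ≤ D)
    (haD : a * D < c)
    (h : ENNReal.ofReal c / ENNReal.ofReal D ≤ max (ENNReal.ofReal a) (1 / ENNReal.ofReal t)) :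
    t ≤ D / c := by
  have hc' : ENNReal.ofReal c ≠ 0 := (ENNReal.ofReal_pos.2 hc).ne'
  have hlt : ENNReal.ofReal a < ENNReal.ofReal c / ENNReal.ofReal D := by
    rw [ENNReal.lt_div_iff_mul_lt (Or.inr ENNReal.ofReal_ne_top) (Or.inl ENNReal.ofReal_ne_top),
      ← ENNReal.ofReal_mul ha]
    exact (ENNReal.ofReal_lt_ofReal_iff hc).2 haD
  have hle := (le_max_iff.1 h).resolve_left hlt.not_ge
  rwa [one_div, ← ENNReal.inv_le_inv, inv_inv,
    ENNReal.inv_div (Or.inl ENNReal.ofReal_ne_top) (Or.inr hc'), ← ENNReal.ofReal_div_of_pos hc,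
    ENNReal.ofReal_le_ofReal_iff (by positivity)] at hle

section Run

variable {n J : ℕ} {L l : Vec n → ℝ} {P : Fin J → Vec n → ℝ} {ρ a c d : ℝ}
  {z : ℕ → Pt n J} {x : ℕ → Vec n} {γ : ℕ → Vec J} {α : ℕ → ℝ}

/-- The tail of a run of VF-iDCA along which the penalty has the constant value `a`.  The
inexactness criterion is stated with the vectors attaining the distance; `linGap_le` is what the
absence of penalty updates amounts to. -/
structure IsConstantPenaltyRun (L l : Vec n → ℝ) (P : Fin J → Vec n → ℝ) (ρ a c : ℝ)
    (z : ℕ → Pt n J) (x : ℕ → Vec n) (γ : ℕ → Vec J) : Prop where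
  mem_sigma : ∀ k, z k ∈ sigmaSet n J
  lower_solution : ∀ k, x k ∈ solutionSet l P (z k).snd
  multiplier : ∀ k, γ k ∈ multipliers l P (x k) (z k).snd
  inexact : ∀ k,
    ∃ ξ₁ ∈ realSubdiff (subObjective L l P ρ a (z (k + 1)) (x (k + 1)) (γ (k + 1))) (z (k + 2)),
      ∃ ξ₂ ∈ normalCone (sigmaSet n J) (z (k + 2)),
        ‖ξ₁ + ξ₂‖ ≤ √2 / 2 * ρ * ‖z (k + 1) - z k‖
  linGap_le : ∀ k, a * ‖z (k + 1) - z k‖ < c →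
    linGap l P (z k).snd (x k) (γ k) (z (k + 1)) ≤ ‖z (k + 1) - z k‖ / c

namespace IsVFiDCARun

theorem exists_penalty_eq (h : IsVFiDCARun L l P ρ c d z x γ α) (hd : 0 < d)
    (hα : Bornology.IsBounded (range α)) : ∃ K, ∃ a, 0 < a ∧ ∀ k, K ≤ k → α k = a := by
  have hmono : Monotone α := monotone_nat_of_le_succ fun k => by
    rw [h.penalty_update k]
    split_ifs <;> linarith
  have hlim := tendsto_atTop_ciSup hmono hα.bddAbove
  have hdiff : Tendsto (fun k => α (k + 1) - α k) atTop (𝓝 0) := by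
    simpa using ((tendsto_add_atTop_iff_nat 1).2 hlim).sub hlim
  obtain ⟨K, hK⟩ := eventually_atTop.1 (hdiff.eventually_lt_const hd)
  refine ⟨K, α K, h.penalty_pos.trans_le (hmono (Nat.zero_le K)), fun k hk => ?_⟩
  induction k, hk using Nat.le_induction with
  | base => rfl
  | succ k hk ih =>
    have hstep := hK k hk
    have hupdate := h.penalty_update k
    split_ifs at hupdate
    · linarith
    · exact hupdate.trans ih

theorem isConstantPenaltyRun (h : IsVFiDCARun L l P ρ c d z x γ α) (hL : ConvexOn ℝ univ L)
    (hl : ConvexOn ℝ univ l) (hP : ∀ i, ConvexOn ℝ univ (P i)) (hρ : 0 ≤ ρ) (hc : 0 < c)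
    (hd : 0 < d) (ha : 0 ≤ a) {K : ℕ} (hK : ∀ k, K ≤ k → α k = a) :
    IsConstantPenaltyRun L l P ρ a c (fun k => z (k + K)) (fun k => x (k + K))
      (fun k => γ (k + K)) where
  mem_sigma k := h.mem_sigma _
  lower_solution k := h.lower_solution _
  multiplier k := h.multiplier _
  inexact k := by
    have hinexact := h.inexact (k + K)
    rw [hK _ (by lia)] at hinexact
    simp only [add_right_comm k _ K]
    exact exists_mem_norm_le_of_infEDist_le (convexOn_subObjective hL hl hP hρ ha) (by positivity)
      hinexact
  linGap_le k hk := by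
    have hupdate := h.penalty_update (k + K)
    rw [hK _ (by lia), hK _ (by lia)] at hupdate
    simp only [add_right_comm k _ K] at hk ⊢
    refine le_div_of_ofReal_div_le_max hc ha (norm_nonneg _) hk (not_lt.1 fun hlt => ?_)
    rw [if_pos hlt] at hupdate
    linarith

end IsVFiDCARun

/-- The value of the merit function at `(z (k + 2), z (k + 1), γ (k + 1))`. -/
noncomputable def meritValue (L l : Vec n → ℝ) (P : Fin J → Vec n → ℝ) (ρ a : ℝ) (z : ℕ → Pt n J)
    (x : ℕ → Vec n) (γ : ℕ → Vec J) (k : ℕ) : ℝ :=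
  L (z (k + 2)).fst + ρ / 4 * ‖z (k + 2) - z (k + 1)‖ ^ 2
    + a * linGap l P (z (k + 1)).snd (x (k + 1)) (γ (k + 1)) (z (k + 2))

namespace IsConstantPenaltyRun

theorem valueFn_eq (h : IsConstantPenaltyRun L l P ρ a c z x γ) (k : ℕ) :
    valueFn l P (z k).snd = l (x k) :=
  valueFn_eq_of_mem_solutionSet (h.lower_solution k)

theorem neg_multiplier_mem (h : IsConstantPenaltyRun L l P ρ a c z x γ) (k : ℕ) :
    -γ k ∈ convexSubdiff (valueFn l P) (z k).snd :=
  neg_mem_convexSubdiff_valueFn (h.lower_solution k) (h.multiplier k)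

theorem merit_eq_meritValue (h : IsConstantPenaltyRun L l P ρ a c z x γ) (k : ℕ) :
    merit L l P ρ a (mkTriple (z (k + 2)) (z (k + 1)) (γ (k + 1)))
      = meritValue L l P ρ a z x γ k :=
  merit_eq (h.valueFn_eq (k + 1)) (h.mem_sigma (k + 2)) (h.neg_multiplier_mem (k + 1))

theorem mul_sq_le_meritValue_sub (h : IsConstantPenaltyRun L l P ρ a c z x γ)
    (hL : ConvexOn ℝ univ L) (hl : ConvexOn ℝ univ l) (hP : ∀ i, ConvexOn ℝ univ (P i))
    (hρ : 0 ≤ ρ) (ha : 0 ≤ a) (k : ℕ) :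
    ρ / 4 * ‖z (k + 3) - z (k + 2)‖ ^ 2
      ≤ meritValue L l P ρ a z x γ k - meritValue L l P ρ a z x γ (k + 1) := by
  obtain ⟨ξ₁, hξ₁, ξ₂, hξ₂, hξ⟩ := h.inexact (k + 1)
  have hstep := add_mul_linGap_add_mul_sq_le hL hl hP ha hξ₁ hξ₂ (h.mem_sigma (k + 2))
  have hgap : linGap l P (z (k + 2)).snd (x (k + 2)) (γ (k + 2)) (z (k + 2))
      ≤ linGap l P (z (k + 1)).snd (x (k + 1)) (γ (k + 1)) (z (k + 2)) :=
    linGap_le_linGap_of_snd_eq (h.valueFn_eq (k + 1)) (h.neg_multiplier_mem (k + 1))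
      (h.lower_solution (k + 2)).1 _ rfl
  have hgap' := mul_le_mul_of_nonneg_left hgap ha
  have hinexact := mul_le_mul_of_nonneg_right hξ (norm_nonneg (z (k + 3) - z (k + 2)))
  have hyoung : √2 / 2 * ‖z (k + 2) - z (k + 1)‖ * ‖z (k + 3) - z (k + 2)‖
      ≤ ‖z (k + 2) - z (k + 1)‖ ^ 2 / 4 + ‖z (k + 3) - z (k + 2)‖ ^ 2 / 2 := by
    have hsq := two_mul_le_add_sq (√2 / 2 * ‖z (k + 2) - z (k + 1)‖) ‖z (k + 3) - z (k + 2)‖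
    rw [mul_pow, div_pow, Real.sq_sqrt zero_le_two] at hsq
    linarith
  have hyoung' := mul_le_mul_of_nonneg_left hyoung hρ
  simp only [meritValue, add_assoc, Nat.reduceAdd] at hstep hgap' hinexact hyoung' ⊢
  linarith

theorem exists_tendsto_meritValue (h : IsConstantPenaltyRun L l P ρ a c z x γ)
    (hL : ConvexOn ℝ univ L) (hl : ConvexOn ℝ univ l) (hP : ∀ i, ConvexOn ℝ univ (P i))
    (hρ : 0 ≤ ρ) (ha : 0 ≤ a) (hz : Bornology.IsBounded (range z)) :
    ∃ e, Tendsto (meritValue L l P ρ a z x γ) atTop (𝓝 e) := by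
  have hanti : Antitone (meritValue L l P ρ a z x γ) := antitone_nat_of_succ_le fun k =>
    sub_nonneg.1 <| (by positivity : 0 ≤ ρ / 4 * ‖z (k + 3) - z (k + 2)‖ ^ 2).trans
      (h.mul_sq_le_meritValue_sub hL hl hP hρ ha k)
  obtain ⟨m, hm⟩ := hz.isCompact_closure.bddBelow_image (continuous_comp_fst hL).continuousOn
  refine ⟨_, tendsto_atTop_ciInf hanti ⟨m, forall_mem_range.2 fun k => ?_⟩⟩
  have hL_ge : m ≤ L (z (k + 2)).fst :=
    hm (mem_image_of_mem _ (subset_closure (mem_range_self (k + 2))))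
  have hgap := mul_nonneg ha (linGap_nonneg (l := l) (P := P) (z (k + 1)).snd (x (k + 1))
    (γ (k + 1)) (z (k + 2)))
  have hprox : 0 ≤ ρ / 4 * ‖z (k + 2) - z (k + 1)‖ ^ 2 := by positivity
  simp only [meritValue]
  linarith

theorem tendsto_linGap (h : IsConstantPenaltyRun L l P ρ a c z x γ) (hc : 0 < c)
    (hD : Tendsto (fun k => ‖z (k + 1) - z k‖) atTop (𝓝 0)) :
    Tendsto (fun k => linGap l P (z k).snd (x k) (γ k) (z (k + 1))) atTop (𝓝 0) := by
  have hsmall : ∀ᶠ k in atTop, a * ‖z (k + 1) - z k‖ < c :=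
    (mul_zero a ▸ hD.const_mul a).eventually_lt_const hc
  exact squeeze_zero' (Eventually.of_forall fun k => linGap_nonneg _ _ _ _)
    (hsmall.mono h.linGap_le) (zero_div c ▸ hD.div_const c)

theorem exists_mem_frechetSubdiff (h : IsConstantPenaltyRun L l P ρ a c z x γ)
    (hL : ConvexOn ℝ univ L) (hl : ConvexOn ℝ univ l) (hP : ∀ i, ConvexOn ℝ univ (P i))
    (hρ : 0 ≤ ρ) (ha : 0 ≤ a) (k : ℕ) :
    ∃ ζ ∈ frechetSubdiff (merit L l P ρ a) (mkTriple (z (k + 2)) (z (k + 1)) (γ (k + 1))),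
      ‖ζ‖ ≤ (ρ + a) * (‖z (k + 1) - z k‖ + ‖z (k + 2) - z (k + 1)‖) := by
  obtain ⟨ξ₁, hξ₁, ξ₂, hξ₂, hξ⟩ := h.inexact k
  obtain ⟨ζ, hζ, hle⟩ := exists_mem_frechetSubdiff_merit hL hl hP hρ ha (h.valueFn_eq (k + 1))
    (h.neg_multiplier_mem (k + 1)) hξ₁ hξ₂
  have hsqrt : √2 / 2 * ρ ≤ ρ + a := by
    have htwo : √2 ≤ 2 := Real.sqrt_le_iff.2 ⟨by norm_num, by norm_num⟩
    linarith [mul_le_mul_of_nonneg_right htwo hρ]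
  refine ⟨ζ, hζ, hle.trans ?_⟩
  linarith [mul_le_mul_of_nonneg_right hsqrt (norm_nonneg (z (k + 1) - z k))]

theorem isBounded_range_multiplier (h : IsConstantPenaltyRun L l P ρ a c z x γ)
    (hz : Bornology.IsBounded (range z)) {y : Vec n} {δ : ℝ} (hδ : 0 < δ)
    (hy : ∀ k i, P i y + δ ≤ (z k).snd i) : Bornology.IsBounded (range γ) := by
  refine isBounded_iff_forall_norm_le.2
    ⟨(l y - l (x 0) + ‖γ 0‖ * Metric.diam (range z)) / δ, forall_mem_range.2 fun k => ?_⟩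
  have hslater := mul_sum_le_of_neg_mem_convexSubdiff_valueFn (h.valueFn_eq k)
    (h.neg_multiplier_mem k) (hy k)
  have hlower := (neg_mem_convexSubdiff_valueFn_iff (h.valueFn_eq 0)).1 (h.neg_multiplier_mem 0)
    (z k).snd (x k) (h.lower_solution k).1
  have hdist : ‖(z k).snd - (z 0).snd‖ ≤ Metric.diam (range z) :=
    (WithLp.norm_snd_le _ (z k - z 0)).trans <| (dist_eq_norm (z k) (z 0)).symm.trans_le <|
      Metric.dist_le_diam_of_mem hz (mem_range_self k) (mem_range_self 0)
  have hinner : inner ℝ (γ 0) ((z k).snd - (z 0).snd) ≤ ‖γ 0‖ * Metric.diam (range z) :=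
    (real_inner_le_norm _ _).trans (by gcongr)
  have hnorm : ‖γ k‖ ≤ ∑ i, γ k i := by
    have hnonneg := (h.multiplier k).1
    refine le_of_sq_le_sq ?_ (Finset.sum_nonneg fun i _ => hnonneg i)
    rw [EuclideanSpace.real_norm_sq_eq]
    exact Finset.sum_sq_le_sq_sum_of_nonneg fun i _ => hnonneg i
  rw [le_div_iff₀' hδ]
  linarith [mul_le_mul_of_nonneg_left hnorm hδ.le]

theorem merit_eq_of_mapClusterPt (h : IsConstantPenaltyRun L l P ρ a c z x γ)
    (hL : ConvexOn ℝ univ L) (hl : ConvexOn ℝ univ l) (hP : ∀ i, ConvexOn ℝ univ (P i))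
    (hc : 0 < c) (hD : Tendsto (fun k => ‖z (k + 1) - z k‖) atTop (𝓝 0)) {e : ℝ}
    (he : Tendsto (meritValue L l P ρ a z x γ) atTop (𝓝 e)) {w : Triple n J}
    (hw : MapClusterPt w atTop fun k => mkTriple (z (k + 2)) (z (k + 1)) (γ (k + 1))) :
    merit L l P ρ a w = e := by
  obtain ⟨φ, hφ, hlim⟩ := hw.tendsto_subseq
  have hnext : Tendsto (fun k => φ k + 1) atTop atTop :=
    (tendsto_add_atTop_nat 1).comp hφ.tendsto_atTop
  have hz₂ : Tendsto (fun k => z (φ k + 2)) atTop (𝓝 w.fst) :=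
    ((WithLp.continuous_fst 2 _ _).tendsto w).comp hlim
  have htail : Tendsto (fun k => WithLp.toLp 2 (z (φ k + 1), γ (φ k + 1))) atTop (𝓝 w.snd) :=
    ((WithLp.continuous_snd 2 _ _).tendsto w).comp hlim
  have hz₁ : Tendsto (fun k => z (φ k + 1)) atTop (𝓝 w.snd.fst) :=
    ((WithLp.continuous_fst 2 _ _).tendsto w.snd).comp htail
  have hγ : Tendsto (fun k => γ (φ k + 1)) atTop (𝓝 w.snd.snd) :=
    ((WithLp.continuous_snd 2 _ _).tendsto w.snd).comp htail
  have heq : w.snd.fst = w.fst := Eq.symm <| sub_eq_zero.1 <| norm_eq_zero.1 <|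
    tendsto_nhds_unique (hz₂.sub hz₁).norm (hD.comp hnext)
  have hr : Tendsto (fun k => (z (φ k + 1)).snd) atTop (𝓝 w.fst.snd) :=
    ((WithLp.continuous_snd 2 _ _).tendsto w.fst).comp (heq ▸ hz₁)
  have hgap := (h.tendsto_linGap hc hD).comp hnext
  have hx := mem_solutionSet_of_tendsto_linGap hl hP (fun k => h.valueFn_eq (φ k + 1))
    (fun k => h.neg_multiplier_mem (φ k + 1)) hr hz₂ hγ hgap
  have hsub := neg_mem_convexSubdiff_of_tendsto_linGap hl hP (fun k => h.valueFn_eq (φ k + 1))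
    (fun k => h.neg_multiplier_mem (φ k + 1)) hr hz₂ hγ hgap
  have hσ := isClosed_sigmaSet.mem_of_tendsto hz₂ (Eventually.of_forall fun k => h.mem_sigma _)
  rw [merit_eq (valueFn_eq_of_mem_solutionSet hx) hσ hsub, linGap_self_eq_zero hx.1,
    EReal.coe_eq_coe_iff]
  refine tendsto_nhds_unique ?_ (he.comp hφ.tendsto_atTop)
  exact ((((continuous_comp_fst hL).tendsto _).comp hz₂).add
    (((hz₂.sub hz₁).norm.pow 2).const_mul _)).add (hgap.const_mul a)

theorem exists_tendsto (h : IsConstantPenaltyRun L l P ρ a c z x γ) (hL : ConvexOn ℝ univ L)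
    (hl : ConvexOn ℝ univ l) (hP : ∀ i, ConvexOn ℝ univ (P i)) (hρ : 0 < ρ) (ha : 0 ≤ a)
    (hc : 0 < c) (hz : Bornology.IsBounded (range z)) (hγ : Bornology.IsBounded (range γ))
    (hKL : IsKLFunction (merit L l P ρ a)) : ∃ z₀, Tendsto z atTop (𝓝 z₀) := by
  obtain ⟨e, he⟩ := h.exists_tendsto_meritValue hL hl hP hρ.le ha hz
  have hdec := h.mul_sq_le_meritValue_sub hL hl hP hρ.le ha
  have hD : Tendsto (fun k => ‖z (k + 1) - z k‖) atTop (𝓝 0) :=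
    (tendsto_add_atTop_iff_nat 2).1 <|
      tendsto_zero_of_mul_sq_le_sub (by positivity) (fun k => norm_nonneg _) hdec he
  obtain ⟨R, hR⟩ := isBounded_iff_forall_norm_le.1 hz
  obtain ⟨M, hM⟩ := isBounded_iff_forall_norm_le.1 hγ
  have hw : Bornology.IsBounded
      (range fun k => mkTriple (z (k + 2)) (z (k + 1)) (γ (k + 1))) :=
    isBounded_iff_forall_norm_le.2 ⟨R + R + M, forall_mem_range.2 fun k =>
      (norm_mkTriple_le _ _ _).trans (add_le_add_three (hR _ (mem_range_self _))
        (hR _ (mem_range_self _)) (hM _ (mem_range_self _)))⟩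
  have hsum : Summable fun k => ‖z (k + 1) - z k‖ :=
    hKL.summable_of_descent hw (by positivity) (by positivity) (fun k => norm_nonneg _)
      h.merit_eq_meritValue hdec he (fun y hy => h.merit_eq_of_mapClusterPt hL hl hP hc hD he hy)
      (h.exists_mem_frechetSubdiff hL hl hP hρ.le ha)
  refine cauchySeq_tendsto_of_complete (cauchySeq_of_summable_dist ?_)
  simpa only [dist_eq_norm, norm_sub_rev] using hsum

theorem exists_approximate_multipliers (h : IsConstantPenaltyRun L l P ρ a c z x γ)
    (hL : ConvexOn ℝ univ L) (hl : ConvexOn ℝ univ l) (hP : ∀ i, ConvexOn ℝ univ (P i))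
    (ha : 0 ≤ a) (k : ℕ) :
    ∃ lam ∈ posMaxMultipliers a fun o =>
        linConstraint l P (z (k + 1)).snd (x (k + 1)) (γ (k + 1)) o (z (k + 2)),
      ∃ ζ : Pt n J, ‖ζ‖ ≤ √2 / 2 * ρ * ‖z (k + 1) - z k‖ + ‖ρ • (z (k + 2) - z (k + 1))‖ ∧
        ∀ y ∈ sigmaSet n J, L (z (k + 2)).fst + inner ℝ ζ (y - z (k + 2)) ≤ L y.fst
          + ∑ o, lam o * linConstraint l P (z (k + 1)).snd (x (k + 1)) (γ (k + 1)) o y := by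
  obtain ⟨ξ₁, hξ₁, ξ₂, hξ₂, hξ⟩ := h.inexact k
  obtain ⟨lam, hlam, hstat⟩ := exists_mem_posMaxMultipliers_linConstraint hL hl hP ha hξ₁
  refine ⟨lam, hlam, ξ₁ + ξ₂ - ρ • (z (k + 2) - z (k + 1)),
    (norm_sub_le _ _).trans (add_le_add hξ le_rfl), fun y hy => ?_⟩
  have hy₁ := hstat y
  have hnormal : inner ℝ ξ₂ (y - z (k + 2)) ≤ 0 := hξ₂.2 y hy
  have hgap := mul_nonneg ha (linGap_nonneg (l := l) (P := P) (z (k + 1)).snd (x (k + 1))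
    (γ (k + 1)) (z (k + 2)))
  rw [add_sub_right_comm, inner_add_left]
  linarith

theorem isKKTStationary_of_tendsto (h : IsConstantPenaltyRun L l P ρ a c z x γ)
    (hL : ConvexOn ℝ univ L) (hl : ConvexOn ℝ univ l) (hP : ∀ i, ConvexOn ℝ univ (P i))
    (ha : 0 ≤ a) (hc : 0 < c) (hγ : Bornology.IsBounded (range γ)) {z₀ : Pt n J}
    (hz : Tendsto z atTop (𝓝 z₀)) : IsKKTStationary L l P z₀ := by
  have hz₁ : Tendsto (fun k => z (k + 1)) atTop (𝓝 z₀) := (tendsto_add_atTop_iff_nat 1).2 hz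
  have hz₂ : Tendsto (fun k => z (k + 2)) atTop (𝓝 z₀) := (tendsto_add_atTop_iff_nat 2).2 hz
  have hD : Tendsto (fun k => ‖z (k + 1) - z k‖) atTop (𝓝 0) := by
    simpa using (hz₁.sub hz).norm
  choose lam hlam ζ hζ hmin using h.exists_approximate_multipliers hL hl hP ha
  have hζ₀ : Tendsto ζ atTop (𝓝 0) := by
    refine squeeze_zero_norm hζ ?_
    simpa using (hD.const_mul (√2 / 2 * ρ)).add ((hz₂.sub hz₁).const_smul ρ).norm
  have hbdd : Bornology.IsBounded (range fun k => (lam k, γ (k + 1))) :=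
    ((Metric.isBounded_Icc (0 : Option (Fin J) → ℝ) fun _ => a).prod hγ).subset <|
      range_subset_iff.2 fun k => ⟨⟨(hlam k).1, le_of_mem_posMaxMultipliers (hlam k)⟩,
        mem_range_self (k + 1)⟩
  obtain ⟨⟨lam₀, γ₀⟩, -, φ, hφ, hlim⟩ := tendsto_subseq_of_bounded hbdd mem_range_self
  have hlamφ : Tendsto (fun k => lam (φ k)) atTop (𝓝 lam₀) := (continuous_fst.tendsto _).comp hlim
  have hγφ : Tendsto (fun k => γ (φ k + 1)) atTop (𝓝 γ₀) := (continuous_snd.tendsto _).comp hlim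
  have hzφ : Tendsto (fun k => z (φ k + 2)) atTop (𝓝 z₀) := hz₂.comp hφ.tendsto_atTop
  have hrφ : Tendsto (fun k => (z (φ k + 1)).snd) atTop (𝓝 z₀.snd) :=
    ((WithLp.continuous_snd 2 _ _).tendsto z₀).comp (hz₁.comp hφ.tendsto_atTop)
  have hgap := (h.tendsto_linGap hc hD).comp
    ((tendsto_add_atTop_nat 1).comp hφ.tendsto_atTop)
  have hv := fun k => h.valueFn_eq (φ k + 1)
  have hsub := fun k => h.neg_multiplier_mem (φ k + 1)
  have hx := tendsto_lower_value_of_tendsto_linGap hl hP hv hsub hrφ hzφ hγφ hgap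
  refine isKKTStationary_of_forall_le (a := a) (lam := lam₀) hL hl hP
    (isClosed_sigmaSet.mem_of_tendsto hz (Eventually.of_forall h.mem_sigma))
    (mem_solutionSet_of_tendsto_linGap hl hP hv hsub hrφ hzφ hγφ hgap)
    (neg_mem_convexSubdiff_of_tendsto_linGap hl hP hv hsub hrφ hzφ hγφ hgap)
    (mem_posMaxMultipliers_of_tendsto (fun k => hlam (φ k)) hlamφ
      (tendsto_pi_nhds.2 (tendsto_linConstraint hl hP hrφ hx hγφ hzφ))) fun y hy => ?_
  have hleft := (((continuous_comp_fst hL).tendsto z₀).comp hzφ).add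
    ((hζ₀.comp hφ.tendsto_atTop).inner ((tendsto_const_nhds (x := y)).sub hzφ))
  have hright := (tendsto_finsetSum Finset.univ fun o _ => (tendsto_pi_nhds.1 hlamφ o).mul
    (tendsto_linConstraint hl hP hrφ hx hγφ (tendsto_const_nhds (x := y)) o)).const_add (L y.fst)
  rw [inner_zero_left, add_zero] at hleft
  exact le_of_tendsto_of_tendsto' hleft hright fun k => hmin (φ k) y hy

end IsConstantPenaltyRun

theorem exists_uniform_slater
    (hne : ∀ r : Vec J, (∀ i, 0 < r i) → (feasible P r).Nonempty)
    (hδ : ∃ δ : ℝ, 0 < δ ∧ ∀ k i, δ ≤ (z k).snd i) :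
    ∃ y, ∃ δ > 0, ∀ k i, P i y + δ ≤ (z k).snd i := by
  obtain ⟨δ, hδ, hz⟩ := hδ
  obtain ⟨y, hy⟩ := hne (WithLp.toLp 2 fun _ => δ / 2) fun _ => half_pos hδ
  exact ⟨y, δ / 2, half_pos hδ, fun k i =>
    (add_le_add_left (hy i) _).trans ((add_halves δ).trans_le (hz k i))⟩

end Run

end ValueFunctionDCA

theorem mainTheorem4_general {n J : ℕ}
    (L l : Vec n → ℝ) (P : Fin J → Vec n → ℝ)
    (hL : ConvexOn ℝ Set.univ L) (hl : ConvexOn ℝ Set.univ l)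
    (hP : ∀ i, ConvexOn ℝ Set.univ (P i))
    (ρ c d : ℝ) (hρ : 0 < ρ) (hc : 0 < c) (hd : 0 < d)
    (z : ℕ → Pt n J) (xt : ℕ → Vec n) (γ : ℕ → Vec J) (α : ℕ → ℝ)
    (hrun : IsVFiDCARun L l P ρ c d z xt γ α)
    (hz : Bornology.IsBounded (Set.range z)) (hα : Bornology.IsBounded (Set.range α))
    (hKL : ∀ a : ℝ, (∀ᶠ k in Filter.atTop, α k = a) → IsKLFunction (merit L l P ρ a))
    (hslater : ∃ y, ∃ δ > 0, ∀ k i, P i y + δ ≤ (z k).snd i) :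
    ∃ zbar : Pt n J, Filter.Tendsto z Filter.atTop (nhds zbar) ∧ IsKKTStationary L l P zbar := by
  obtain ⟨y, δ, hδ, hy⟩ := hslater
  obtain ⟨K, a, ha, hK⟩ := hrun.exists_penalty_eq hd hα
  have htail := hrun.isConstantPenaltyRun hL hl hP hρ.le hc hd ha.le hK
  have hz_tail := hz.subset (range_comp_subset_range (fun k => k + K) z)
  have hγ_tail := htail.isBounded_range_multiplier hz_tail hδ fun k i => hy (k + K) i
  obtain ⟨zbar, hlim⟩ := htail.exists_tendsto hL hl hP hρ ha.le hc hz_tail hγ_tail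
    (hKL a (eventually_atTop.2 ⟨K, hK⟩))
  exact ⟨zbar, (tendsto_add_atTop_iff_nat K).1 hlim,
    htail.isKKTStationary_of_tendsto hL hl hP ha.le hc hγ_tail hlim⟩

theorem mainTheorem4 {n J : ℕ}
    (L l : Vec n → ℝ) (P : Fin J → Vec n → ℝ)
    (hL : ConvexOn ℝ Set.univ L) (hl : ConvexOn ℝ Set.univ l)
    (hP : ∀ i, ConvexOn ℝ Set.univ (P i)) (hP0 : ∀ i x, 0 ≤ P i x)
    (hLL : ∀ r : Vec J, (∀ i, 0 < r i) →
      (feasible P r).Nonempty ∧ BddBelow (l '' feasible P r))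
    (ρ c d : ℝ) (hρ : 0 < ρ) (hc : 0 < c) (hd : 0 < d)
    (z : ℕ → Pt n J) (xt : ℕ → Vec n) (γ : ℕ → Vec J) (α : ℕ → ℝ)
    (hrun : IsVFiDCARun L l P ρ c d z xt γ α)
    (hLbdd : BddBelow (Set.range L))
    (hz : Bornology.IsBounded (Set.range z)) (hα : Bornology.IsBounded (Set.range α))
    (hKL : ∀ a : ℝ, (∀ᶠ k in Filter.atTop, α k = a) → IsKLFunction (merit L l P ρ a))
    (hδ : ∃ δ : ℝ, 0 < δ ∧ ∀ k i, δ ≤ (z k).snd i) :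
    ∃ zbar : Pt n J, Filter.Tendsto z Filter.atTop (nhds zbar) ∧ IsKKTStationary L l P zbar :=
  mainTheorem4_general L l P hL hl hP ρ c d hρ hc hd z xt γ α hrun hz hα hKL
    (exists_uniform_slater (fun r hr => (hLL r hr).1) hδ)
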